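/- Let $m,n\in\mathbb{N}_0$ with $m+n>1$ and let $\Theta=\{\theta_{ij}\in\mathbb{R}:1\le i<j\le m+n\}$. Let $B_\Theta^{m,n}$ be the universal (unital) $C^*$-algebra generated by elements $s_1,\dots,s_{m+n}$ subject to the relations $s_is_j=e^{2\pi \mathrm{i}\theta_{ij}}s_js_i$ for $1\le i<j\le m+n$, $s_i^*s_i=1$ for $1\le i\le m+n$, and $s_is_i^*=1$ for $1\le i\le m$. Let $J_n$ be the closed two-sided ideal of $B_\Theta^{m,n}$ generated by the defect projection $1-(s_1s_2\cdots s_{m+n})(s_1s_2\cdots s_{m+n})^*$. Let $\mathcal{K}$ denote the $C^*$-algebra of compact operators on $\ell^2(\mathbb{N}_0)$, and call a $C^*$-algebra $A$ stable if $A\cong\mathcal{K}\otimes A$. Let $\pi$ be a unital representation ($*$-homomorphism) of $B_\Theta^{m,n}$ into the bounded operators on a Hilbert space $\mathcal{H}$, let $P=1-\pi(s_1\cdots s_{m+n})\pi(s_1\cdots s_{m+n})^*$ and $E_n=P\pi(J_n)P$. Then $\pi(J_n)$ and $E_n$ are (norm closed) $C^*$-algebras of operators on $\mathcal{H}$, $\pi(J_n)\cong\mathcal{K}\otimes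 E_n$, and $\pi(J_n)$ is stable. Moreover, the $C^*$-algebra $J_n$ itself is stable. -/

import Mathlib

open scoped ENNReal TensorProduct

noncomputable section

/-! ### The universal C⋆-algebra of free twisted isometries -/

/-- The defining relations of `B_Θ^{m,n}` for a tuple `s` (indexed from `0`): all `s i` are
isometries, the first `m` of them are unitaries, and `s i * s j = e^{2πi θ i j} s j * s i` for
`i < j`. Only the entries `θ i j` with `i < j` matter. -/
structure IsTwistedTuple (m n : ℕ) (θ : Fin (m + n) → Fin (m + n) → ℝ) {A : Type*}
    [Ring A] [StarRing A] [Algebra ℂ A] (s : Fin (m + n) → A) : Prop where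
  twist : ∀ i j, i < j →
    s i * s j = Complex.exp (2 * Real.pi * Complex.I * (θ i j : ℂ)) • (s j * s i)
  isometry : ∀ i, star (s i) * s i = 1
  unitary : ∀ i : Fin (m + n), (i : ℕ) < m → s i * star (s i) = 1

/-- A tuple of bounded operators on a (nonzero) Hilbert space satisfying the relations. -/
structure TwistedTuple (m n : ℕ) (θ : Fin (m + n) → Fin (m + n) → ℝ) : Type 1 where
  H : Type
  [instNorm : NormedAddCommGroup H]
  [instInner : InnerProductSpace ℂ H]
  [instComplete : CompleteSpace H]
  [instNontrivial : Nontrivial H]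
  S : Fin (m + n) → (H →L[ℂ] H)
  isTwisted : IsTwistedTuple m n θ S

attribute [instance] TwistedTuple.instNorm TwistedTuple.instInner TwistedTuple.instComplete
  TwistedTuple.instNontrivial

/-- The C⋆-algebra of bounded families of operators, one operator for each Hilbert space tuple
satisfying the relations. -/
abbrev TwistedFamily (m n : ℕ) (θ : Fin (m + n) → Fin (m + n) → ℝ) : Type 1 :=
  lp (fun r : TwistedTuple m n θ => r.H →L[ℂ] r.H) ∞

instance TwistedFamily.cstarAlgebra (m n : ℕ) (θ : Fin (m + n) → Fin (m + n) → ℝ) :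
    CStarAlgebra (TwistedFamily m n θ) where

theorem TwistedTuple.norm_le_one {m n : ℕ} {θ : Fin (m + n) → Fin (m + n) → ℝ}
    (r : TwistedTuple m n θ) (i : Fin (m + n)) : ‖r.S i‖ ≤ 1 := by
  have h := CStarRing.norm_star_mul_self (x := r.S i)
  rw [r.isTwisted.isometry i, norm_one] at h
  nlinarith [norm_nonneg (r.S i)]

/-- The `i`-th universal generator: the family of the `i`-th entries of all tuples. -/
def twistedFamilyGen (m n : ℕ) (θ : Fin (m + n) → Fin (m + n) → ℝ) (i : Fin (m + n)) :
    TwistedFamily m n θ :=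
  ⟨fun r => r.S i, memℓp_infty ⟨1, by rintro _ ⟨r, rfl⟩; exact r.norm_le_one i⟩⟩

/-- The closed unital ⋆-subalgebra generated by the universal generators. -/
def freeTwistSubalgebra (m n : ℕ) (θ : Fin (m + n) → Fin (m + n) → ℝ) :
    StarSubalgebra ℂ (TwistedFamily m n θ) :=
  (StarAlgebra.adjoin ℂ (Set.range (twistedFamilyGen m n θ))).topologicalClosure

instance freeTwistSubalgebra.isClosed (m n : ℕ) (θ : Fin (m + n) → Fin (m + n) → ℝ) :
    IsClosed (freeTwistSubalgebra m n θ : Set (TwistedFamily m n θ)) :=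
  StarSubalgebra.isClosed_topologicalClosure _

/-- `B_Θ^{m,n}`: the universal (unital) C⋆-algebra generated by `s 0, …, s (m+n-1)` subject to the
relations `IsTwistedTuple`. It is the completion of the ⋆-polynomials in the generators for the
norm `‖f‖ = sup ‖f(S)‖` over all tuples `S` of Hilbert space operators satisfying the relations,
realised as a closed subalgebra of a product. (Hilbert spaces in the lowest universe suffice, since
the norm is already attained on separable ones.) -/
def FreeTwist (m n : ℕ) (θ : Fin (m + n) → Fin (m + n) → ℝ) : Type 1 :=
  ↥(freeTwistSubalgebra m n θ)

/-- The C⋆-algebra structure inherited from the product. -/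
def FreeTwist.cstarAlgebra (m n : ℕ) (θ : Fin (m + n) → Fin (m + n) → ℝ) :
    CStarAlgebra (FreeTwist m n θ) :=
  StarSubalgebra.cstarAlgebra (freeTwistSubalgebra m n θ)

attribute [instance] FreeTwist.cstarAlgebra

namespace FreeTwist

variable (m n : ℕ) (θ : Fin (m + n) → Fin (m + n) → ℝ)

/-- The standard generators `s i` of `B_Θ^{m,n}`. -/
def gen (i : Fin (m + n)) : FreeTwist m n θ :=
  ⟨twistedFamilyGen m n θ i, StarSubalgebra.le_topologicalClosure _
    (StarAlgebra.subset_adjoin ℂ _ (Set.mem_range_self i))⟩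

/-- The ordered product `s 0 * s 1 * ⋯ * s (m+n-1)` of all generators. -/
def prodGen : FreeTwist m n θ := (List.ofFn (gen m n θ)).prod

/-- The defect projection `1 - v v⋆` of the isometry `v = s 0 * ⋯ * s (m+n-1)`. -/
def defect : FreeTwist m n θ := 1 - prodGen m n θ * star (prodGen m n θ)

theorem isSelfAdjoint_defect : IsSelfAdjoint (defect m n θ) := by
  simp [IsSelfAdjoint, defect]

theorem isTwistedTuple_gen : IsTwistedTuple m n θ (gen m n θ) where
  twist i j h := by
    apply Subtype.ext; apply lp.ext; funext r
    exact r.isTwisted.twist i j h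
  isometry i := by
    apply Subtype.ext; apply lp.ext; funext r
    exact r.isTwisted.isometry i
  unitary i h := by
    apply Subtype.ext; apply lp.ext; funext r
    exact r.isTwisted.unitary i h

/-- The standard generators generate `B_Θ^{m,n}` as a C⋆-algebra. -/
theorem topologicalClosure_adjoin_gen :
    (StarAlgebra.adjoin ℂ (Set.range (gen m n θ))).topologicalClosure = ⊤ := by
  let ι : FreeTwist m n θ →⋆ₐ[ℂ] TwistedFamily m n θ :=
    { toFun := fun x => x.1
      map_one' := rfl
      map_mul' := fun _ _ => rfl
      map_zero' := rfl
      map_add' := fun _ _ => rfl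
      commutes' := fun _ => rfl
      map_star' := fun _ => rfl }
  have hι : Isometry ι := fun _ _ => rfl
  have hmap : (StarAlgebra.adjoin ℂ (Set.range (gen m n θ))).map ι =
      StarAlgebra.adjoin ℂ (Set.range (twistedFamilyGen m n θ)) := by
    rw [StarAlgHom.map_adjoin, ← Set.range_comp]; rfl
  rw [eq_top_iff]
  rintro x -
  change x ∈ closure _
  rw [hι.isEmbedding.isInducing.closure_eq_preimage_closure_image]
  change ι x ∈ closure _
  have hx : ι x ∈ (StarAlgebra.adjoin ℂ
    (Set.range (twistedFamilyGen m n θ))).topologicalClosure := x.2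
  rw [← hmap] at hx
  exact hx

/-- Universal property: every tuple of Hilbert space operators satisfying the relations is the
image of the standard generators under a unital representation. -/
theorem exists_lift (r : TwistedTuple m n θ) :
    ∃ π : FreeTwist m n θ →⋆ₐ[ℂ] (r.H →L[ℂ] r.H), ∀ i, π (gen m n θ i) = r.S i :=
  ⟨{ toFun := fun x => (x.1 : ∀ r : TwistedTuple m n θ, r.H →L[ℂ] r.H) r
     map_one' := rfl
     map_mul' := fun _ _ => rfl
     map_zero' := rfl
     map_add' := fun _ _ => rfl
     commutes' := fun _ => rfl
     map_star' := fun _ => rfl }, fun _ => rfl⟩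

end FreeTwist

/-! ### Closed ideals and corners -/

/-- The closed two-sided ideal generated by a set `S` that is closed under the involution, as a
⋆-subalgebra. -/
def closedIdealSpan {A : Type*} [CStarAlgebra A] (S : Set A) (hS : ∀ x ∈ S, star x ∈ S) :
    NonUnitalStarSubalgebra ℂ A where
  carrier := closure (TwoSidedIdeal.span S : Set A)
  zero_mem' := subset_closure (TwoSidedIdeal.span S).zero_mem
  add_mem' hx hy := map_mem_closure₂ continuous_add hx hy
    fun _ ha _ hb => (TwoSidedIdeal.span S).add_mem ha hb
  mul_mem' hx hy := map_mem_closure₂ continuous_mul hx hy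
    fun _ ha _ _ => (TwoSidedIdeal.span S).mul_mem_right _ _ ha
  smul_mem' c x hx := map_mem_closure (continuous_const_smul c) hx fun a ha => by
    have := (TwoSidedIdeal.span S).mul_mem_left (c • (1 : A)) a ha
    simpa using this
  star_mem' hx := map_mem_closure continuous_star hx fun a ha => by
    rw [SetLike.mem_coe, TwoSidedIdeal.mem_span_iff_mem_addSubgroup_closure] at ha ⊢
    induction ha using AddSubgroup.closure_induction with
    | mem x hx =>
      obtain ⟨_, ⟨a, -, s, hs, rfl⟩, b, -, rfl⟩ := hx
      refine AddSubgroup.subset_closure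
        ⟨star b * star s, ⟨star b, trivial, star s, hS s hs, rfl⟩, star a, trivial, ?_⟩
      simp [mul_assoc]
    | zero => simp
    | add x y _ _ hx hy => rw [star_add]; exact add_mem hx hy
    | neg x _ hx => rw [star_neg]; exact neg_mem hx

instance closedIdealSpan.isClosed {A : Type*} [CStarAlgebra A] (S : Set A)
    (hS : ∀ x ∈ S, star x ∈ S) : IsClosed (closedIdealSpan S hS : Set A) :=
  isClosed_closure

/-- The corner `p A p` of a ⋆-algebra `A` of operators, for a self-adjoint `p ∈ A`. -/
def corner {B : Type*} [CStarAlgebra B] (A : NonUnitalStarSubalgebra ℂ B) (p : B)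
    (hp : IsSelfAdjoint p) (hpA : p ∈ A) : NonUnitalStarSubalgebra ℂ B where
  carrier := {y | ∃ x ∈ A, p * x * p = y}
  zero_mem' := ⟨0, A.zero_mem, by simp⟩
  add_mem' := by
    rintro _ _ ⟨x, hx, rfl⟩ ⟨y, hy, rfl⟩
    exact ⟨x + y, A.add_mem hx hy, by simp [mul_add, add_mul]⟩
  mul_mem' := by
    rintro _ _ ⟨x, hx, rfl⟩ ⟨y, hy, rfl⟩
    exact ⟨x * p * p * y, A.mul_mem (A.mul_mem (A.mul_mem hx hpA) hpA) hy, by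
      simp only [mul_assoc]⟩
  smul_mem' := by
    rintro c _ ⟨x, hx, rfl⟩
    exact ⟨c • x, SMulMemClass.smul_mem c hx, by simp⟩
  star_mem' := by
    rintro _ ⟨x, hx, rfl⟩
    exact ⟨star x, star_mem hx, by simp [hp.star_eq, mul_assoc]⟩

namespace FreeTwist

variable (m n : ℕ) (θ : Fin (m + n) → Fin (m + n) → ℝ)

/-- The closed two-sided ideal `J_n` of `B_Θ^{m,n}` generated by the defect projection. -/
def defectIdeal : NonUnitalStarSubalgebra ℂ (FreeTwist m n θ) :=
  closedIdealSpan {defect m n θ} (by rintro _ rfl; exact isSelfAdjoint_defect m n θ)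

theorem defect_mem_defectIdeal : defect m n θ ∈ defectIdeal m n θ :=
  subset_closure (TwoSidedIdeal.subset_span rfl)

instance : NonUnitalCStarAlgebra (defectIdeal m n θ) :=
  haveI : IsClosed (defectIdeal m n θ : Set (FreeTwist m n θ)) := isClosed_closure
  NonUnitalStarSubalgebra.nonUnitalCStarAlgebra (defectIdeal m n θ)

variable {m n θ} {H : Type*} [NormedAddCommGroup H] [InnerProductSpace ℂ H] [CompleteSpace H]

/-- The image `π(J_n)` under a unital representation `π` of `B_Θ^{m,n}`. -/
def imageIdeal (π : FreeTwist m n θ →⋆ₐ[ℂ] (H →L[ℂ] H)) :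
    NonUnitalStarSubalgebra ℂ (H →L[ℂ] H) :=
  (defectIdeal m n θ).map π.toNonUnitalStarAlgHom

/-- `E_n = P π(J_n) P`, where `P = π(defect)` is the defect projection of the isometry
`π(s 0 * ⋯ * s (m+n-1))`. -/
def imageCorner (π : FreeTwist m n θ →⋆ₐ[ℂ] (H →L[ℂ] H)) :
    NonUnitalStarSubalgebra ℂ (H →L[ℂ] H) :=
  corner (imageIdeal π) (π (defect m n θ)) ((isSelfAdjoint_defect m n θ).map π)
    ⟨_, defect_mem_defectIdeal m n θ, rfl⟩

end FreeTwist

/-! ### Tensoring with the compact operators, and stability -/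

/-- The Hilbert space tensor product `ℓ²(ℕ) ⊗ H`. -/
def EllTwoTensor (H : Type*) [NormedAddCommGroup H] [InnerProductSpace ℂ H] : Type _ :=
  UniformSpace.Completion (lp (fun _ : ℕ => ℂ) 2 ⊗[ℂ] H)

section EllTwoTensor

variable (H : Type*) [NormedAddCommGroup H] [InnerProductSpace ℂ H]

instance : NormedAddCommGroup (EllTwoTensor H) :=
  inferInstanceAs (NormedAddCommGroup (UniformSpace.Completion (lp (fun _ : ℕ => ℂ) 2 ⊗[ℂ] H)))

instance : InnerProductSpace ℂ (EllTwoTensor H) :=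
  inferInstanceAs (InnerProductSpace ℂ (UniformSpace.Completion (lp (fun _ : ℕ => ℂ) 2 ⊗[ℂ] H)))

instance : CompleteSpace (EllTwoTensor H) :=
  inferInstanceAs (CompleteSpace (UniformSpace.Completion (lp (fun _ : ℕ => ℂ) 2 ⊗[ℂ] H)))

end EllTwoTensor

section Stable

variable {H : Type*} [NormedAddCommGroup H] [InnerProductSpace ℂ H] [CompleteSpace H]

/-- The operator `k ⊗ a` on `ℓ²(ℕ) ⊗ H`. -/
def opTensor (k : lp (fun _ : ℕ => ℂ) 2 →L[ℂ] lp (fun _ : ℕ => ℂ) 2) (a : H →L[ℂ] H) :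
    EllTwoTensor H →L[ℂ] EllTwoTensor H :=
  (TensorProduct.mapL k a).completion

/-- The C⋆-tensor product `K ⊗ A` of the compact operators `K` on `ℓ²(ℕ)` with a C⋆-algebra `A` of
operators on `H`: the C⋆-algebra on `ℓ²(ℕ) ⊗ H` generated by the operators `k ⊗ a` with `k`
compact and `a ∈ A`. (This is the spatial tensor product; as `K` is nuclear, there is no other.) -/
def compactTensor (A : NonUnitalStarSubalgebra ℂ (H →L[ℂ] H)) :
    NonUnitalStarSubalgebra ℂ (EllTwoTensor H →L[ℂ] EllTwoTensor H) :=
  (NonUnitalStarAlgebra.adjoin ℂ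
    {T | ∃ k : lp (fun _ : ℕ => ℂ) 2 →L[ℂ] lp (fun _ : ℕ => ℂ) 2, ∃ a ∈ A,
      IsCompactOperator k ∧ T = opTensor k a}).topologicalClosure

/-- An operator algebra `A` is stable if `A ≅ K ⊗ A`. -/
def IsStableOn (A : NonUnitalStarSubalgebra ℂ (H →L[ℂ] H)) : Prop :=
  Nonempty (A ≃⋆ₐ[ℂ] compactTensor A)

end Stable

/-- A C⋆-algebra `A` is stable if `A ≅ K ⊗ A`, where the tensor product is formed in a faithful
representation of `A` on a Hilbert space (its isomorphism class does not depend on the choice). -/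
def IsStable.{u} (A : Type u) [NonUnitalCStarAlgebra A] : Prop :=
  ∃ (H : Type u) (_ : NormedAddCommGroup H) (_ : InnerProductSpace ℂ H) (_ : CompleteSpace H)
    (ρ : A →⋆ₙₐ[ℂ] (H →L[ℂ] H)),
    Function.Injective ρ ∧ IsStableOn (NonUnitalStarAlgHom.range ρ)

end

/-! Let V be the product of all generators, an isometry, and p = 1 - V V⋆. The elements V^a p V⋆^b
(`woldUnit`) are matrix units lying in J, and 1 - V^k V⋆^k is the sum of the first k diagonal ones.

The algebraic heart is that these projections form an approximate unit of J (`tendsto_one_sub_mul`).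
By density it suffices that V⋆^k a p = 0 for every ⋆-polynomial a and all large k
(`exists_star_pow_mul_eq_zero`). Nothing is assumed about s_i⋆ s_j for i ≠ j, but V⋆ commutes with
each s_i⋆ up to a scalar, and V⋆ s_i is a multiple of w⋆, where w is the product of the remaining
generators and commutes with V up to a scalar. So powers of V⋆ can be pushed through a until they
reach p, at the cost of one power for each factor s_i.

Both isomorphisms are then one spatial construction. The partial isometries h ↦ δ_{c k} ⊗ V^{d k} p
V⋆^k h from H to ℓ² ⊗ H have orthogonal initial spaces, and orthogonal ranges if k ↦ (c k, d k) is
injective; let T be their strong sum. As the partial sums of T⋆T and TT⋆ are approximate units of J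
and of K ⊗ E, conjugation by T identifies these algebras (`nonempty_starAlgEquiv`). Taking c k = k,
d k = 0 gives E = pJp, and taking (c, d) to be a bijection of ℕ with ℕ × ℕ gives E = J.

Closedness of π(J) is closedness of ranges of ⋆-homomorphisms. Stability of J itself is the case of
a faithful π, the diagonal representation on the Hilbert sum of all tuples. -/

/-! ### Strong sums of partial isometries and conjugation by them -/

section StrongSum

open ContinuousLinearMap InnerProductSpace Filter Topology

variable {H : Type*} [NormedAddCommGroup H] [InnerProductSpace ℂ H] [CompleteSpace H]
  {G : Type*} [NormedAddCommGroup G] [InnerProductSpace ℂ G] [CompleteSpace G]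

/-- A sequence of partial isometries with pairwise orthogonal initial spaces and pairwise
orthogonal final spaces. -/
structure IsOrthogonalPartialIsometries (f : ℕ → H →L[ℂ] G) : Prop where
  adjoint_comp : ∀ k l, k ≠ l → adjoint (f k) ∘L f l = 0
  comp_adjoint : ∀ k l, k ≠ l → f k ∘L adjoint (f l) = 0
  comp_self : ∀ k, f k ∘L adjoint (f k) ∘L f k = f k

namespace IsOrthogonalPartialIsometries

variable {f : ℕ → H →L[ℂ] G}

theorem symm (hf : IsOrthogonalPartialIsometries f) :
    IsOrthogonalPartialIsometries fun k => adjoint (f k) where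
  adjoint_comp k l h := by simpa using hf.comp_adjoint k l h
  comp_adjoint k l h := by simpa using hf.adjoint_comp k l h
  comp_self k := by
    have := congrArg adjoint (hf.comp_self k)
    simpa only [ContinuousLinearMap.adjoint_comp, adjoint_adjoint, comp_assoc] using this

theorem inner_apply (hf : IsOrthogonalPartialIsometries f) {k l : ℕ} (h : k ≠ l) (x y : H) :
    inner ℂ (f k x) (f l y) = 0 := by
  rw [← adjoint_inner_right, ← comp_apply, hf.adjoint_comp k l h]
  simp

/-- Bessel's inequality: w = ∑ f_k⋆ f_k x is a projection of x, with ⟨w, w⟩ = ⟨w, x⟩ = ∑ ‖f_k x‖²,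
so Cauchy–Schwarz applies. -/
theorem sum_norm_sq_le (hf : IsOrthogonalPartialIsometries f) (s : Finset ℕ) (x : H) :
    ∑ k ∈ s, ‖f k x‖ ^ 2 ≤ ‖x‖ ^ 2 := by
  set w := ∑ k ∈ s, adjoint (f k) (f k x) with hw
  have h1 : ∀ k ∈ s, f k w = f k x := by
    intro k hk
    rw [hw, map_sum, Finset.sum_eq_single_of_mem k hk]
    · exact congrArg (fun A : H →L[ℂ] G => A x) (hf.comp_self k)
    · intro l _ hl
      rw [← comp_apply, hf.comp_adjoint k l hl.symm]
      simp
  have h2 : inner ℂ w x = ((∑ k ∈ s, ‖f k x‖ ^ 2 : ℝ) : ℂ) := by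
    rw [hw, sum_inner]
    push_cast
    refine Finset.sum_congr rfl fun k _ => ?_
    rw [adjoint_inner_left, inner_self_eq_norm_sq_to_K]
    rfl
  have h3 : inner ℂ w w = ((∑ k ∈ s, ‖f k x‖ ^ 2 : ℝ) : ℂ) := by
    conv_lhs => rw [hw, sum_inner]
    push_cast
    refine Finset.sum_congr rfl fun k hk => ?_
    rw [adjoint_inner_left, ← hw, h1 k hk, inner_self_eq_norm_sq_to_K]
    rfl
  have h4 : ‖w‖ ^ 2 = ∑ k ∈ s, ‖f k x‖ ^ 2 := by
    rw [inner_self_eq_norm_sq_to_K] at h3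
    exact Complex.ofReal_injective (by simpa using h3)
  have h5 : ∑ k ∈ s, ‖f k x‖ ^ 2 ≤ ‖w‖ * ‖x‖ := by
    have := re_inner_le_norm (𝕜 := ℂ) w x
    rwa [h2, RCLike.re_eq_complex_re, Complex.ofReal_re] at this
  rw [← h4] at h5 ⊢
  nlinarith [norm_nonneg w, norm_nonneg x, sq_nonneg (‖w‖ - ‖x‖)]

theorem summable_apply (hf : IsOrthogonalPartialIsometries f) (x : H) :
    Summable fun k => f k x := by
  let S : ℕ → Submodule ℂ G := fun k => (f k).range
  have hS : OrthogonalFamily ℂ (fun k => S k) fun k => (S k).subtypeₗᵢ := by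
    rintro k l hkl ⟨_, x, rfl⟩ ⟨_, y, rfl⟩
    exact hf.inner_apply hkl x y
  have := (hS.summable_iff_norm_sq_summable fun k => ⟨f k x, x, rfl⟩).2
    (summable_of_sum_le (fun _ => by positivity) fun s => hf.sum_norm_sq_le s x)
  exact this

theorem exists_norm_sum_le (hf : IsOrthogonalPartialIsometries f) :
    ∃ M, ∀ n, ‖∑ k ∈ Finset.range n, f k‖ ≤ M := by
  refine banach_steinhaus fun x => ?_
  obtain ⟨C, hC⟩ := (hf.summable_apply x).hasSum.tendsto_sum_nat.norm.bddAbove_range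
  exact ⟨C, fun n => by simpa only [sum_apply] using hC ⟨n, rfl⟩⟩

/-- The range projections. -/
theorem comp_adjoint_self (hf : IsOrthogonalPartialIsometries f) :
    IsOrthogonalPartialIsometries fun k => f k ∘L adjoint (f k) where
  adjoint_comp k l h := by
    simp only [ContinuousLinearMap.adjoint_comp, adjoint_adjoint]
    rw [comp_assoc, ← comp_assoc _ _ (adjoint (f l)), hf.adjoint_comp k l h]
    simp
  comp_adjoint k l h := by
    simp only [ContinuousLinearMap.adjoint_comp, adjoint_adjoint]
    rw [comp_assoc, ← comp_assoc _ _ (adjoint (f l)), hf.adjoint_comp k l h]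
    simp
  comp_self k := by
    simp only [ContinuousLinearMap.adjoint_comp, adjoint_adjoint]
    have := congrArg (· ∘L adjoint (f k)) (hf.comp_self k)
    simp only [comp_assoc] at this ⊢
    rw [this, this]

/-- The strong sum of the partial isometries. -/
theorem exists_strongSum (hf : IsOrthogonalPartialIsometries f) :
    ∃ T : H →L[ℂ] G, (∀ k, T ∘L adjoint (f k) = f k ∘L adjoint (f k)) ∧
      ∀ k, adjoint T ∘L f k = adjoint (f k) ∘L f k := by
  have hlim : Tendsto (fun (n : ℕ) (x : H) => (∑ k ∈ Finset.range n, f k) x) atTop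
      (𝓝 fun x => ∑' k, f k x) := by
    rw [tendsto_pi_nhds]
    intro x
    simpa only [sum_apply] using (hf.summable_apply x).hasSum.tendsto_sum_nat
  -- The pointwise limit of bounded operators on a Banach space is bounded by Banach–Steinhaus;
  -- orthogonality leaves one term in each series below.
  refine ⟨continuousLinearMapOfTendsto _ hlim, fun k => ?_, fun k => ?_⟩
  · ext y
    change ∑' l, f l (adjoint (f k) y) = f k (adjoint (f k) y)
    refine tsum_eq_single k fun l hl => ?_
    rw [← comp_apply, hf.comp_adjoint l k hl, zero_apply]
  · ext x
    refine ext_inner_right ℂ fun y => ?_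
    rw [comp_apply, comp_apply, adjoint_inner_left, adjoint_inner_left]
    change inner ℂ (f k x) (∑' l, f l y) = _
    rw [← innerSL_apply_apply ℂ, (innerSL ℂ (f k x)).map_tsum (hf.summable_apply y)]
    exact tsum_eq_single k fun l hl => hf.inner_apply hl.symm x y

/-- Compressing by the strong sum maps `J` to `C`, when each `f k` does. -/
theorem strongSum_conj (hf : IsOrthogonalPartialIsometries f) {T : H →L[ℂ] G}
    (hT : ∀ k, T ∘L adjoint (f k) = f k ∘L adjoint (f k))
    (hT' : ∀ k, adjoint T ∘L f k = adjoint (f k) ∘L f k)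
    {J : NonUnitalStarSubalgebra ℂ (H →L[ℂ] H)} {C : NonUnitalStarSubalgebra ℂ (G →L[ℂ] G)}
    (hC : IsClosed (C : Set (G →L[ℂ] G)))
    (hJC : ∀ k l, ∀ x ∈ J, f k ∘L x ∘L adjoint (f l) ∈ C)
    (hJ : ∀ x ∈ J, Tendsto (fun m => (∑ k ∈ Finset.range m, adjoint (f k) ∘L f k) * x) atTop
      (𝓝 x)) {x : H →L[ℂ] H} (hx : x ∈ J) :
    adjoint T ∘L T ∘L x = x ∧ T ∘L x ∘L adjoint T ∈ C := by
  set Q : ℕ → H →L[ℂ] H := fun m => ∑ k ∈ Finset.range m, adjoint (f k) ∘L f k with hQ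
  have hQs : ∀ m, star (Q m) = Q m := by
    intro m
    simp [hQ, star_sum, star_eq_adjoint, ContinuousLinearMap.adjoint_comp]
  have hTQ : ∀ m, T ∘L Q m = ∑ k ∈ Finset.range m, f k := by
    intro m
    simp only [hQ, comp_finsetSum, ← comp_assoc, hT]
    exact Finset.sum_congr rfl fun k _ => hf.comp_self k
  have hxQ : Tendsto (fun m => x * Q m) atTop (𝓝 x) := by
    have : Tendsto (fun m => Q m * star x) atTop (𝓝 (star x)) := hJ (star x) (star_mem hx)
    simpa only [star_mul, hQs, star_star] using this.star
  constructor
  · have h1 : Tendsto (fun m => (adjoint T ∘L T) * (Q m * x)) atTop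
        (𝓝 ((adjoint T ∘L T) * x)) := (hJ x hx).const_mul _
    have h2 : ∀ m, (adjoint T ∘L T) * (Q m * x) = Q m * x := by
      intro m
      rw [← mul_assoc]
      congr 1
      rw [mul_def, comp_assoc, hTQ, comp_finsetSum]
      simp only [hT', hQ]
    simp only [h2] at h1
    exact tendsto_nhds_unique h1 (hJ x hx)
  -- T Q_m is a finite sum of the f_k, so the two-sided cut-off lands in C algebraically. The limits
  -- in n and then in m are norm limits because x lies in J.
  · have key : ∀ m n, T ∘L (Q m * x * Q n) ∘L adjoint T ∈ C := by
      intro m n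
      have : T ∘L (Q m * x * Q n) ∘L adjoint T =
          ∑ k ∈ Finset.range m, ∑ l ∈ Finset.range n, f k ∘L x ∘L adjoint (f l) := by
        have h3 : Q n ∘L adjoint T = ∑ k ∈ Finset.range n, adjoint (f k) := by
          rw [← hQs n, star_eq_adjoint, ← ContinuousLinearMap.adjoint_comp, hTQ, map_sum]
        calc T ∘L (Q m * x * Q n) ∘L adjoint T = (T ∘L Q m) ∘L x ∘L (Q n ∘L adjoint T) := by
              simp only [mul_def, comp_assoc]
          _ = _ := by
              rw [hTQ, h3]
              simp only [comp_finsetSum, finsetSum_comp]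
              exact Finset.sum_comm
      rw [this]
      exact sum_mem fun k _ => sum_mem fun l _ => hJC k l x hx
    have hcont : Continuous fun z : H →L[ℂ] H => T ∘L z ∘L adjoint T := by fun_prop
    have key2 : ∀ m, T ∘L (Q m * x) ∘L adjoint T ∈ C := fun m =>
      hC.mem_of_tendsto ((hcont.tendsto _).comp (by
        simpa only [mul_assoc] using hxQ.const_mul (Q m))) (Eventually.of_forall fun n => key m n)
    exact hC.mem_of_tendsto ((hcont.tendsto _).comp (hJ x hx)) (Eventually.of_forall key2)

/-- T is only a partial isometry, but T⋆T fixes J and TT⋆ fixes C, by the two approximate unit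
hypotheses. The situation is symmetric under f ↦ f⋆, which gives the inverse map. -/
theorem nonempty_starAlgEquiv (hf : IsOrthogonalPartialIsometries f)
    {J : NonUnitalStarSubalgebra ℂ (H →L[ℂ] H)} {C : NonUnitalStarSubalgebra ℂ (G →L[ℂ] G)}
    (hJcl : IsClosed (J : Set (H →L[ℂ] H))) (hCcl : IsClosed (C : Set (G →L[ℂ] G)))
    (hJC : ∀ k l, ∀ x ∈ J, f k ∘L x ∘L adjoint (f l) ∈ C)
    (hCJ : ∀ k l, ∀ y ∈ C, adjoint (f k) ∘L y ∘L f l ∈ J)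
    (hJ : ∀ x ∈ J, Tendsto (fun m => (∑ k ∈ Finset.range m, adjoint (f k) ∘L f k) * x) atTop
      (𝓝 x))
    (hC : ∀ y ∈ C, Tendsto (fun m => (∑ k ∈ Finset.range m, f k ∘L adjoint (f k)) * y) atTop
      (𝓝 y)) :
    Nonempty (J ≃⋆ₐ[ℂ] C) := by
  obtain ⟨T, hT, hT'⟩ := hf.exists_strongSum
  have h1 : ∀ x ∈ J, _ := fun x hx => hf.strongSum_conj hT hT' hCcl hJC hJ hx
  have h2 : ∀ y ∈ C, T ∘L adjoint T ∘L y = y ∧ adjoint T ∘L y ∘L T ∈ J := fun y hy => by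
    have := hf.symm.strongSum_conj (T := adjoint T) (J := C) (C := J)
      (by simpa using hT') (by simpa using hT) hJcl (by simpa using hCJ) (by simpa using hC) hy
    simpa using this
  have h1' : ∀ x ∈ J, x ∘L adjoint T ∘L T = x := fun x hx => by
    have := congrArg adjoint (h1 _ (star_mem hx)).1
    simpa [ContinuousLinearMap.adjoint_comp, star_eq_adjoint, comp_assoc] using this
  have h2' : ∀ y ∈ C, y ∘L T ∘L adjoint T = y := fun x hx => by
    have := congrArg adjoint (h2 _ (star_mem hx)).1
    simpa [ContinuousLinearMap.adjoint_comp, star_eq_adjoint, comp_assoc] using this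
  refine ⟨{ toFun := fun x => ⟨T ∘L x.1 ∘L adjoint T, (h1 x.1 x.2).2⟩
            invFun := fun y => ⟨adjoint T ∘L y.1 ∘L T, (h2 y.1 y.2).2⟩
            left_inv := ?_
            right_inv := ?_
            map_mul' := ?_
            map_add' := ?_
            map_star' := ?_
            map_smul' := ?_ }⟩
  · rintro ⟨x, hx⟩
    apply Subtype.ext
    change adjoint T ∘L (T ∘L x ∘L adjoint T) ∘L T = x
    calc _ = (adjoint T ∘L T ∘L x) ∘L adjoint T ∘L T := by simp only [comp_assoc]
      _ = x := by rw [(h1 x hx).1, h1' x hx]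
  · rintro ⟨y, hy⟩
    apply Subtype.ext
    change T ∘L (adjoint T ∘L y ∘L T) ∘L adjoint T = y
    calc _ = (T ∘L adjoint T ∘L y) ∘L T ∘L adjoint T := by simp only [comp_assoc]
      _ = y := by rw [(h2 y hy).1, h2' y hy]
  · rintro ⟨x, hx⟩ ⟨y, hy⟩
    apply Subtype.ext
    change T ∘L (x ∘L y) ∘L adjoint T = (T ∘L x ∘L adjoint T) ∘L (T ∘L y ∘L adjoint T)
    -- Multiplicativity holds because x = x T⋆T.
    conv_lhs => rw [← h1' x hx]
    simp only [comp_assoc]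
  · rintro ⟨x, hx⟩ ⟨y, hy⟩
    apply Subtype.ext
    change T ∘L (x + y) ∘L adjoint T = T ∘L x ∘L adjoint T + T ∘L y ∘L adjoint T
    simp only [add_comp, comp_add]
  · rintro ⟨x, hx⟩
    apply Subtype.ext
    change T ∘L star x ∘L adjoint T = star (T ∘L x ∘L adjoint T)
    simp only [star_eq_adjoint, ContinuousLinearMap.adjoint_comp, adjoint_adjoint, comp_assoc]
  · rintro c ⟨x, hx⟩
    apply Subtype.ext
    change T ∘L (c • x) ∘L adjoint T = c • (T ∘L x ∘L adjoint T)
    simp only [smul_comp, comp_smul]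

end IsOrthogonalPartialIsometries

end StrongSum

/-! ### Strong convergence becomes norm convergence on compact operators -/

section CompactApproximation

open ContinuousLinearMap Filter Topology

variable {E F : Type*} [NormedAddCommGroup E] [NormedSpace ℂ E]
  [NormedAddCommGroup F] [NormedSpace ℂ F] [CompleteSpace F]

/-- An approximate identity for the strong topology is one for the norm on compact operators. -/
theorem IsCompactOperator.tendsto_comp {k : E →L[ℂ] F} (hk : IsCompactOperator k)
    {p : ℕ → F →L[ℂ] F} (hp : ∀ y, Tendsto (fun n => p n y) atTop (𝓝 y)) :
    Tendsto (fun n => p n ∘L k) atTop (𝓝 k) := by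
  obtain ⟨M, hM⟩ : ∃ M, ∀ n, ‖p n‖ ≤ M := banach_steinhaus fun y => by
    obtain ⟨C, hC⟩ := (hp y).norm.bddAbove_range
    exact ⟨C, fun n => hC ⟨n, rfl⟩⟩
  have hM0 : 0 ≤ M := (norm_nonneg _).trans (hM 0)
  have hK : IsCompact (closure (k '' Metric.closedBall 0 1)) :=
    hk.isCompact_closure_image_closedBall (f := (k : E →ₗ[ℂ] F)) 1
  rw [Metric.tendsto_atTop]
  intro ε hε
  set δ := ε / (2 * (M + 2)) with hδ
  have hδ0 : 0 < δ := by positivity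
  -- A finite δ-net of the image of the unit ball turns pointwise convergence into uniform
  -- convergence; δ is chosen so that (M + 2) δ = ε / 2.
  obtain ⟨t, -, htf, ht⟩ := hK.finite_cover_balls hδ0
  have hev : ∀ᶠ n in atTop, ∀ y ∈ t, ‖p n y - y‖ < δ := by
    rw [htf.eventually_all]
    intro y _
    simpa [dist_eq_norm] using (Metric.tendsto_nhds.1 (hp y)) δ hδ0
  obtain ⟨N, hN⟩ := eventually_atTop.1 hev
  refine ⟨N, fun n hn => ?_⟩
  rw [dist_eq_norm]
  have hle : ‖p n ∘L k - k‖ ≤ ε / 2 := by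
    refine opNorm_le_of_unit_norm (by positivity) fun x hx => ?_
    have hx' : k x ∈ closure (k '' Metric.closedBall 0 1) :=
      subset_closure ⟨x, by simp [hx], rfl⟩
    obtain ⟨y, hy, hxy⟩ := Set.mem_iUnion₂.1 (ht hx')
    rw [Metric.mem_ball, dist_eq_norm] at hxy
    have h1 := hN n hn y hy
    have h2 : ‖p n (k x - y)‖ ≤ M * δ :=
      ((p n).le_opNorm _).trans (mul_le_mul (hM n) hxy.le (norm_nonneg _) hM0)
    calc ‖(p n ∘L k - k) x‖ = ‖p n (k x - y) + (p n y - y) - (k x - y)‖ := by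
          congr 1; simp
      _ ≤ ‖p n (k x - y)‖ + ‖p n y - y‖ + ‖k x - y‖ :=
          (norm_sub_le _ _).trans (add_le_add_left (norm_add_le _ _) _)
      _ ≤ M * δ + δ + δ := by gcongr
      _ = ε / 2 := by rw [hδ]; field_simp; ring
  linarith

end CompactApproximation

/-! ### Matrix units in the tensor product with the compact operators -/

section TensorInsertion

open ContinuousLinearMap InnerProductSpace Filter Topology

noncomputable section

variable {H : Type*} [NormedAddCommGroup H] [InnerProductSpace ℂ H]

/-- The elementary tensor `u ⊗ h` in `ℓ²(ℕ) ⊗ H`. -/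
def EllTwoTensor.tmul (u : lp (fun _ : ℕ => ℂ) 2) (h : H) : EllTwoTensor H :=
  ((u ⊗ₜ[ℂ] h : lp (fun _ : ℕ => ℂ) 2 ⊗[ℂ] H) : UniformSpace.Completion _)

/-- The operator `h ↦ u ⊗ h`. -/
def tensorInsert (u : lp (fun _ : ℕ => ℂ) 2) : H →L[ℂ] EllTwoTensor H :=
  (UniformSpace.Completion.toComplL (𝕜 := ℂ) (E := lp (fun _ : ℕ => ℂ) 2 ⊗[ℂ] H)) ∘L
    TensorProduct.mkL ℂ _ _ u

theorem tensorInsert_apply (u : lp (fun _ : ℕ => ℂ) 2) (h : H) :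
    tensorInsert u h = EllTwoTensor.tmul u h := rfl

theorem EllTwoTensor.add_tmul (u v : lp (fun _ : ℕ => ℂ) 2) (h : H) :
    tmul (u + v) h = tmul u h + tmul v h :=
  (congrArg ((↑) : lp (fun _ : ℕ => ℂ) 2 ⊗[ℂ] H →
    UniformSpace.Completion (lp (fun _ : ℕ => ℂ) 2 ⊗[ℂ] H))
    (TensorProduct.add_tmul u v h)).trans (UniformSpace.Completion.coe_add _ _)

theorem EllTwoTensor.smul_tmul (c : ℂ) (u : lp (fun _ : ℕ => ℂ) 2) (h : H) :
    tmul (c • u) h = c • tmul u h :=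
  (congrArg ((↑) : lp (fun _ : ℕ => ℂ) 2 ⊗[ℂ] H →
    UniformSpace.Completion (lp (fun _ : ℕ => ℂ) 2 ⊗[ℂ] H))
    (TensorProduct.smul_tmul' c u h).symm).trans (UniformSpace.Completion.coe_smul _ _)

theorem EllTwoTensor.inner_tmul (u v : lp (fun _ : ℕ => ℂ) 2) (h h' : H) :
    inner ℂ (tmul u h) (tmul v h') = inner ℂ u v * inner ℂ h h' :=
  (UniformSpace.Completion.inner_coe _ _).trans (TensorProduct.inner_tmul ℂ u v h h')

theorem EllTwoTensor.ext_tmul {F : Type*} [NormedAddCommGroup F] [NormedSpace ℂ F]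
    {S T : EllTwoTensor H →L[ℂ] F} (hST : ∀ u h, S (tmul u h) = T (tmul u h)) : S = T := by
  ext x
  refine UniformSpace.Completion.induction_on
    (p := fun x : EllTwoTensor H => S x = T x) x (isClosed_eq S.continuous T.continuous) fun y => ?_
  induction y using TensorProduct.induction_on with
  | zero => exact (map_zero S).trans (map_zero T).symm
  | tmul u h => exact hST u h
  | add a b ha hb =>
    rw [UniformSpace.Completion.coe_add]
    exact (map_add S _ _).trans ((congrArg₂ _ ha hb).trans (map_add T _ _).symm)

variable [CompleteSpace H]

omit [CompleteSpace H] in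
theorem opTensor_tmul (k : lp (fun _ : ℕ => ℂ) 2 →L[ℂ] lp (fun _ : ℕ => ℂ) 2) (a : H →L[ℂ] H)
    (u : lp (fun _ : ℕ => ℂ) 2) (h : H) :
    opTensor k a (EllTwoTensor.tmul u h) = EllTwoTensor.tmul (k u) (a h) := by
  change UniformSpace.Completion.map (TensorProduct.mapL k a) _ = _
  exact UniformSpace.Completion.map_coe (TensorProduct.mapL k a).uniformContinuous _

theorem adjoint_tensorInsert_tmul (u v : lp (fun _ : ℕ => ℂ) 2) (h : H) :
    adjoint (tensorInsert u) (EllTwoTensor.tmul v h) = inner ℂ u v • h := by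
  refine ext_inner_left ℂ fun y => ?_
  rw [adjoint_inner_right, tensorInsert_apply, EllTwoTensor.inner_tmul, inner_smul_right]

theorem adjoint_tensorInsert_comp (u v : lp (fun _ : ℕ => ℂ) 2) :
    adjoint (tensorInsert (H := H) u) ∘L tensorInsert v = (inner ℂ u v : ℂ) • 1 := by
  ext h
  exact adjoint_tensorInsert_tmul u v h

theorem opTensor_rankOne (u v : lp (fun _ : ℕ => ℂ) 2) (a : H →L[ℂ] H) :
    opTensor (rankOne ℂ u v) a = tensorInsert u ∘L a ∘L adjoint (tensorInsert v) := by
  refine EllTwoTensor.ext_tmul fun w h => ?_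
  rw [opTensor_tmul, comp_apply, comp_apply, adjoint_tensorInsert_tmul, rankOne_apply,
    map_smul, map_smul, tensorInsert_apply, EllTwoTensor.smul_tmul]

/-- `k ↦ k ⊗ a` as a continuous linear map. -/
def opTensorL (a : H →L[ℂ] H) : (lp (fun _ : ℕ => ℂ) 2 →L[ℂ] lp (fun _ : ℕ => ℂ) 2) →L[ℂ]
    (EllTwoTensor H →L[ℂ] EllTwoTensor H) :=
  LinearMap.mkContinuous
    { toFun := fun k => opTensor k a
      map_add' := fun k l => by
        refine EllTwoTensor.ext_tmul fun w h => ?_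
        rw [add_apply, opTensor_tmul, opTensor_tmul, opTensor_tmul, add_apply,
          EllTwoTensor.add_tmul]
      map_smul' := fun c k => by
        refine EllTwoTensor.ext_tmul fun w h => ?_
        rw [smul_apply, opTensor_tmul, opTensor_tmul, smul_apply, EllTwoTensor.smul_tmul]
        rfl }
    ‖a‖ fun k => by
      refine opNorm_le_bound _ (by positivity) fun x => ?_
      refine UniformSpace.Completion.induction_on
        (p := fun x : EllTwoTensor H => ‖opTensor k a x‖ ≤ ‖a‖ * ‖k‖ * ‖x‖) x
        (isClosed_le (opTensor k a).continuous.norm (continuous_const.mul continuous_norm))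
        fun y => ?_
      have h1 : opTensor k a (y : UniformSpace.Completion (lp (fun _ : ℕ => ℂ) 2 ⊗[ℂ] H)) =
          (TensorProduct.mapL k a y : UniformSpace.Completion (lp (fun _ : ℕ => ℂ) 2 ⊗[ℂ] H)) :=
        UniformSpace.Completion.map_coe (TensorProduct.mapL k a).uniformContinuous _
      rw [h1]
      refine (UniformSpace.Completion.norm_coe _).le.trans
        (((TensorProduct.mapL k a).le_opNorm y).trans ?_)
      refine mul_le_mul ((TensorProduct.norm_mapL_le k a).trans_eq (mul_comm _ _))
        (UniformSpace.Completion.norm_coe y).ge (norm_nonneg _) (by positivity)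

/-- The standard orthonormal basis of `ℓ²(ℕ)`. -/
def ellTwoBasis (i : ℕ) : lp (fun _ : ℕ => ℂ) 2 := lp.single 2 i 1

theorem inner_ellTwoBasis (i j : ℕ) :
    inner ℂ (ellTwoBasis i) (ellTwoBasis j) = if i = j then 1 else 0 := by
  rw [ellTwoBasis, lp.inner_single_left, ellTwoBasis, lp.single_apply]
  simp [Pi.single_apply]

theorem hasSum_ellTwoBasis (v : lp (fun _ : ℕ => ℂ) 2) :
    HasSum (fun i => inner ℂ (ellTwoBasis i) v • ellTwoBasis i) v := by
  convert lp.hasSum_single (p := 2) (by simp) v using 2 with i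
  rw [ellTwoBasis, lp.inner_single_left, ← lp.single_smul]
  simp

/-- The generators `e_{ij} ⊗ a` of `K ⊗ A`. -/
def matrixUnitTensors (A : NonUnitalStarSubalgebra ℂ (H →L[ℂ] H)) :
    Set (EllTwoTensor H →L[ℂ] EllTwoTensor H) :=
  {y | ∃ i j, ∃ a ∈ A, tensorInsert (ellTwoBasis i) ∘L a ∘L
    adjoint (tensorInsert (ellTwoBasis j)) = y}

theorem matrixUnitTensor_mem_compactTensor {A : NonUnitalStarSubalgebra ℂ (H →L[ℂ] H)}
    {a : H →L[ℂ] H} (ha : a ∈ A) (u v : lp (fun _ : ℕ => ℂ) 2) :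
    tensorInsert u ∘L a ∘L adjoint (tensorInsert v) ∈ compactTensor A := by
  rw [← opTensor_rankOne]
  refine NonUnitalStarSubalgebra.le_topologicalClosure _
    (NonUnitalStarAlgebra.subset_adjoin ℂ _ ⟨_, a, ha, ?_, rfl⟩)
  rw [rankOne_def']
  have h : IsCompactOperator (toSpanSingleton ℂ u) :=
    isCompactOperator_of_locallyCompactSpace_rng _
  exact h.comp_clm (innerSL ℂ v)

theorem opTensor_mem_closure_span {A : NonUnitalStarSubalgebra ℂ (H →L[ℂ] H)} {a : H →L[ℂ] H}
    (ha : a ∈ A) {k : lp (fun _ : ℕ => ℂ) 2 →L[ℂ] lp (fun _ : ℕ => ℂ) 2}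
    (hk : IsCompactOperator k) :
    opTensor k a ∈ (Submodule.span ℂ (matrixUnitTensors A)).topologicalClosure := by
  set D := (Submodule.span ℂ (matrixUnitTensors A)).topologicalClosure
  have hD : IsClosed (D : Set (EllTwoTensor H →L[ℂ] EllTwoTensor H)) :=
    Submodule.isClosed_topologicalClosure _
  -- Expand v in the standard basis; `rankOne` is conjugate-linear in v, so the coefficients come
  -- out conjugated.
  have h1 : ∀ i v, opTensorL a (rankOne ℂ (ellTwoBasis i) v) ∈ D := by
    intro i v
    have hs := ((opTensorL a).hasSum ((rankOne ℂ (ellTwoBasis i)).hasSum (hasSum_ellTwoBasis v)))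
    refine hD.mem_of_tendsto hs (Eventually.of_forall fun s => sum_mem fun j _ => ?_)
    rw [map_smulₛₗ, map_smul]
    refine D.smul_mem _ (Submodule.le_topologicalClosure _ (Submodule.subset_span ⟨i, j, a, ha, ?_⟩))
    exact (opTensor_rankOne _ _ _).symm
  -- Compactness makes k the norm limit of its first n rows, and each row e_i e_i⋆ k is the rank one
  -- operator with vectors e_i and k⋆ e_i.
  have h2 := hk.tendsto_comp
    (p := fun n => ∑ i ∈ Finset.range n, rankOne ℂ (ellTwoBasis i) (ellTwoBasis i)) fun y => by
      simpa only [sum_apply, rankOne_apply] using (hasSum_ellTwoBasis y).tendsto_sum_nat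
  refine hD.mem_of_tendsto (((opTensorL a).continuous.tendsto _).comp h2)
    (Eventually.of_forall fun n => ?_)
  rw [Function.comp_apply, finsetSum_comp, map_sum]
  refine sum_mem fun i _ => ?_
  have : rankOne ℂ (ellTwoBasis i) (ellTwoBasis i) ∘L k =
      rankOne ℂ (ellTwoBasis i) (adjoint k (ellTwoBasis i)) := by
    ext1 x
    simp [adjoint_inner_left]
  rw [this]
  exact h1 _ _

theorem mul_mem_matrixUnitTensors {A : NonUnitalStarSubalgebra ℂ (H →L[ℂ] H)}
    {x y : EllTwoTensor H →L[ℂ] EllTwoTensor H} (hx : x ∈ matrixUnitTensors A)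
    (hy : y ∈ matrixUnitTensors A) : x * y ∈ matrixUnitTensors A := by
  obtain ⟨i, j, a, ha, rfl⟩ := hx
  obtain ⟨k, l, b, hb, rfl⟩ := hy
  have : (tensorInsert (ellTwoBasis i) ∘L a ∘L adjoint (tensorInsert (ellTwoBasis j))) *
      (tensorInsert (ellTwoBasis k) ∘L b ∘L adjoint (tensorInsert (ellTwoBasis l))) =
      tensorInsert (ellTwoBasis i) ∘L a ∘L (adjoint (tensorInsert (ellTwoBasis j)) ∘L
        tensorInsert (ellTwoBasis k)) ∘L b ∘L adjoint (tensorInsert (ellTwoBasis l)) := by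
    simp only [mul_def, comp_assoc]
  rw [this, adjoint_tensorInsert_comp]
  refine ⟨i, l, (inner ℂ (ellTwoBasis j) (ellTwoBasis k) : ℂ) • (a * b),
    SMulMemClass.smul_mem _ (mul_mem ha hb), ?_⟩
  simp only [mul_def, smul_comp, comp_smul, one_def, id_comp, comp_assoc]

theorem star_mem_matrixUnitTensors {A : NonUnitalStarSubalgebra ℂ (H →L[ℂ] H)}
    {x : EllTwoTensor H →L[ℂ] EllTwoTensor H} (hx : x ∈ matrixUnitTensors A) :
    star x ∈ matrixUnitTensors A := by
  obtain ⟨i, j, a, ha, rfl⟩ := hx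
  refine ⟨j, i, star a, star_mem ha, ?_⟩
  simp only [star_eq_adjoint, ContinuousLinearMap.adjoint_comp, adjoint_adjoint, comp_assoc]

/-- The set of all e_{ij} ⊗ a is already closed under products and adjoints, so the ⋆-algebra it
generates is its linear span. -/
theorem compactTensor_subset_closure_span (A : NonUnitalStarSubalgebra ℂ (H →L[ℂ] H)) :
    (compactTensor A : Set (EllTwoTensor H →L[ℂ] EllTwoTensor H)) ⊆
      (Submodule.span ℂ (matrixUnitTensors A)).topologicalClosure := by
  have hspan : (NonUnitalStarAlgebra.adjoin ℂ (matrixUnitTensors A)).toSubmodule =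
      Submodule.span ℂ (matrixUnitTensors A) := by
    rw [NonUnitalStarAlgebra.adjoin_eq_span]
    congr 1
    refine Set.Subset.antisymm ?_
      (Set.subset_union_left.trans Subsemigroup.subset_closure)
    have hle : Subsemigroup.closure (matrixUnitTensors A ∪ star (matrixUnitTensors A)) ≤
        ⟨matrixUnitTensors A, mul_mem_matrixUnitTensors⟩ := by
      refine Subsemigroup.closure_le.2 (Set.union_subset subset_rfl fun x hx => ?_)
      change x ∈ matrixUnitTensors A
      simpa using star_mem_matrixUnitTensors (Set.mem_star.1 hx)
    exact hle
  have hle : compactTensor A ≤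
      (NonUnitalStarAlgebra.adjoin ℂ (matrixUnitTensors A)).topologicalClosure := by
    refine NonUnitalStarSubalgebra.topologicalClosure_minimal _
      (NonUnitalStarAlgebra.adjoin_le ?_)
      (NonUnitalStarSubalgebra.isClosed_topologicalClosure _)
    rintro _ ⟨k, a, ha, hk, rfl⟩
    have := opTensor_mem_closure_span ha hk
    rw [← hspan] at this
    exact this
  intro x hx
  have := hle hx
  rw [← hspan]
  exact this

/-- To prove a closed additive property on `K ⊗ A` it suffices to check the `e_{ij} ⊗ a`. -/
theorem compactTensor_induction {A : NonUnitalStarSubalgebra ℂ (H →L[ℂ] H)}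
    {p : (EllTwoTensor H →L[ℂ] EllTwoTensor H) → Prop} (hcl : IsClosed {y | p y})
    (hadd : ∀ x y, p x → p y → p (x + y))
    (hgen : ∀ i j, ∀ a ∈ A, p (tensorInsert (ellTwoBasis i) ∘L a ∘L
      adjoint (tensorInsert (ellTwoBasis j))))
    {y : EllTwoTensor H →L[ℂ] EllTwoTensor H} (hy : y ∈ compactTensor A) : p y := by
  refine closure_minimal (s := (Submodule.span ℂ (matrixUnitTensors A) :
    Set (EllTwoTensor H →L[ℂ] EllTwoTensor H))) (t := {y | p y}) ?_ hcl
    (compactTensor_subset_closure_span A hy)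
  intro z hz
  change z ∈ Submodule.span ℂ (matrixUnitTensors A) at hz
  induction hz using Submodule.closure_induction with
  | zero => simpa using hgen 0 0 0 A.zero_mem
  | add x y _ _ hx hy => exact hadd x y hx hy
  | smul_mem c x hx =>
    obtain ⟨i, j, a, ha, rfl⟩ := hx
    have := hgen i j (c • a) (SMulMemClass.smul_mem c ha)
    rwa [smul_comp, comp_smul] at this

end

end TensorInsertion

/-! ### Bounded approximate units -/

section ApproximateUnit

open Filter Topology

/-- The elements on which a bounded sequence acts as a left approximate unit form a closed set. -/
theorem isClosed_setOf_tendsto_mul {A : Type*} [NormedRing A] {R : ℕ → A} {M : ℝ}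
    (hR : ∀ n, ‖R n‖ ≤ M) : IsClosed {y | Tendsto (fun n => R n * y) atTop (𝓝 y)} := by
  refine isClosed_of_closure_subset fun y hy => ?_
  have hM0 : 0 ≤ M := (norm_nonneg _).trans (hR 0)
  change Tendsto _ _ _
  rw [Metric.tendsto_atTop]
  intro ε hε
  obtain ⟨z, hz, hyz⟩ := Metric.mem_closure_iff.1 hy (ε / (2 * (M + 2))) (by positivity)
  obtain ⟨N, hN⟩ := Metric.tendsto_atTop.1 hz (ε / 2) (by positivity)
  refine ⟨N, fun n hn => ?_⟩
  have h1 := hN n hn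
  rw [dist_eq_norm] at h1 hyz ⊢
  calc ‖R n * y - y‖ = ‖R n * (y - z) + (R n * z - z) - (y - z)‖ := by
        congr 1; rw [mul_sub]; abel
    _ ≤ ‖R n * (y - z)‖ + ‖R n * z - z‖ + ‖y - z‖ :=
        (norm_sub_le _ _).trans (add_le_add_left (norm_add_le _ _) _)
    _ < M * (ε / (2 * (M + 2))) + ε / 2 + ε / (2 * (M + 2)) := by
        have h2 : ‖R n * (y - z)‖ ≤ M * (ε / (2 * (M + 2))) :=
          (norm_mul_le _ _).trans (mul_le_mul (hR n) hyz.le (norm_nonneg _) hM0)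
        linarith
    _ ≤ ε := by
        have : M * (ε / (2 * (M + 2))) + ε / (2 * (M + 2)) = ε / 2 * ((M + 1) / (M + 2)) := by
          field_simp
        have h3 : (M + 1) / (M + 2) ≤ 1 := (div_le_one (by positivity)).2 (by linarith)
        nlinarith

end ApproximateUnit

/-! ### Matrix units of an isometry -/

section WoldMatrixUnits

variable {R : Type*} [Ring R] [StarRing R]

/-- The matrix units `V^a (1 - V V⋆) V⋆^b` attached to an isometry `V`. -/
def woldUnit (V : R) (a b : ℕ) : R := V ^ a * (1 - V * star V) * star V ^ b

theorem star_woldUnit (V : R) (a b : ℕ) : star (woldUnit V a b) = woldUnit V b a := by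
  simp [woldUnit, mul_assoc]

theorem woldUnit_zero_zero (V : R) : woldUnit V 0 0 = 1 - V * star V := by simp [woldUnit]

theorem sum_woldUnit (V : R) (m : ℕ) :
    ∑ k ∈ Finset.range m, woldUnit V k k = 1 - V ^ m * star V ^ m := by
  induction m with
  | zero => simp
  | succ m ih =>
    rw [Finset.sum_range_succ, ih, woldUnit, pow_succ V, pow_succ' (star V)]
    noncomm_ring

variable {V : R}

theorem star_mul_one_sub (hV : star V * V = 1) : star V * (1 - V * star V) = 0 := by
  rw [mul_sub, ← mul_assoc, hV]; simp

theorem one_sub_mul_self (hV : star V * V = 1) : (1 - V * star V) * V = 0 := by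
  rw [sub_mul, mul_assoc, hV]; simp

theorem one_sub_mul_one_sub (hV : star V * V = 1) :
    (1 - V * star V) * (1 - V * star V) = 1 - V * star V := by
  rw [sub_mul, one_mul, mul_assoc, star_mul_one_sub hV, mul_zero, sub_zero]

theorem star_pow_mul_pow (hV : star V * V = 1) (a : ℕ) : star V ^ a * V ^ a = 1 := by
  induction a with
  | zero => simp
  | succ a ih => rw [pow_succ, pow_succ', mul_assoc, ← mul_assoc (star V) V, hV, one_mul, ih]

/-- The inner factor p V⋆^b V^c p reduces to p V^{c-b} p or p V⋆^{b-c} p, which vanishes for b ≠ c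
since p V = 0 = V⋆ p. -/
theorem woldUnit_mul_woldUnit (hV : star V * V = 1) (a b c d : ℕ) :
    woldUnit V a b * woldUnit V c d = if b = c then woldUnit V a d else 0 := by
  have key : woldUnit V a b * woldUnit V c d =
      V ^ a * ((1 - V * star V) * (star V ^ b * V ^ c) * (1 - V * star V)) * star V ^ d := by
    simp only [woldUnit, mul_assoc]
  rw [key]
  rcases lt_trichotomy b c with h | h | h
  · obtain ⟨e, rfl⟩ := Nat.exists_eq_add_of_lt h
    rw [if_neg h.ne, add_assoc, pow_add V, ← mul_assoc (star V ^ b), star_pow_mul_pow hV, one_mul,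
      pow_succ', ← mul_assoc _ V, one_sub_mul_self hV]
    simp
  · subst h
    rw [if_pos rfl, star_pow_mul_pow hV, mul_one, one_sub_mul_one_sub hV, woldUnit]
  · obtain ⟨e, rfl⟩ := Nat.exists_eq_add_of_lt h
    rw [if_neg h.ne', show c + e + 1 = e + 1 + c by ring, pow_add (star V), mul_assoc (star V ^ _),
      star_pow_mul_pow hV, mul_one, pow_succ, mul_assoc (1 - V * star V), mul_assoc (star V ^ e),
      star_mul_one_sub hV]
    simp

end WoldMatrixUnits

/-! ### The isomorphisms of J with K ⊗ pJp and K ⊗ J -/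

section Stabilisation

open ContinuousLinearMap Filter Topology

variable {H : Type*} [NormedAddCommGroup H] [InnerProductSpace ℂ H] [CompleteSpace H]

/-- The partial isometries `h ↦ δ_{c k} ⊗ V^{d k} (1 - V V⋆) V⋆^k h`. -/
noncomputable def woldInsert (V : H →L[ℂ] H) (c d : ℕ → ℕ) (k : ℕ) : H →L[ℂ] EllTwoTensor H :=
  tensorInsert (ellTwoBasis (c k)) ∘L woldUnit V (d k) k

theorem adjoint_ellTwoBasis_comp (i j : ℕ) :
    adjoint (tensorInsert (H := H) (ellTwoBasis i)) ∘L tensorInsert (ellTwoBasis j) =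
      if i = j then 1 else 0 := by
  rw [adjoint_tensorInsert_comp, inner_ellTwoBasis]
  split_ifs <;> simp

theorem adjoint_woldUnit (V : H →L[ℂ] H) (a b : ℕ) :
    adjoint (woldUnit V a b) = woldUnit V b a := by
  rw [← star_eq_adjoint, star_woldUnit]

theorem adjoint_woldInsert_comp_tensorInsert (V : H →L[ℂ] H) (c d : ℕ → ℕ) (k i : ℕ) :
    adjoint (woldInsert V c d k) ∘L tensorInsert (ellTwoBasis i) =
      if c k = i then woldUnit V k (d k) else 0 := by
  rw [woldInsert, ContinuousLinearMap.adjoint_comp, comp_assoc, adjoint_ellTwoBasis_comp,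
    adjoint_woldUnit]
  split_ifs
  · rw [one_def, comp_id]
  · rw [comp_zero]

theorem adjoint_woldInsert_comp (V : H →L[ℂ] H) (c d : ℕ → ℕ) (k l : ℕ) :
    adjoint (woldInsert V c d k) ∘L woldInsert V c d l =
      if c k = c l then woldUnit V k (d k) * woldUnit V (d l) l else 0 := by
  rw [woldInsert.eq_def V c d l, ← comp_assoc, adjoint_woldInsert_comp_tensorInsert]
  split_ifs
  · rfl
  · rw [zero_comp]

theorem woldInsert_conj (V : H →L[ℂ] H) (c d : ℕ → ℕ) (k l : ℕ) (x : H →L[ℂ] H) :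
    woldInsert V c d k ∘L x ∘L adjoint (woldInsert V c d l) =
      tensorInsert (ellTwoBasis (c k)) ∘L (woldUnit V (d k) k * x * woldUnit V l (d l)) ∘L
        adjoint (tensorInsert (ellTwoBasis (c l))) := by
  simp only [woldInsert, ContinuousLinearMap.adjoint_comp, adjoint_woldUnit, mul_def, comp_assoc]

theorem isOrthogonalPartialIsometries_woldInsert {V : H →L[ℂ] H} (hV : star V * V = 1)
    {c d : ℕ → ℕ} (hcd : ∀ k l, c k = c l → d k = d l → k = l) :
    IsOrthogonalPartialIsometries (woldInsert V c d) where
  adjoint_comp k l h := by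
    rw [adjoint_woldInsert_comp, woldUnit_mul_woldUnit hV]
    split_ifs with h1 h2
    · exact absurd (hcd k l h1 h2) h
    all_goals rfl
  comp_adjoint k l h := by
    have := woldInsert_conj V c d k l 1
    rw [one_def, id_comp, ← one_def, mul_one, woldUnit_mul_woldUnit hV, if_neg h] at this
    rw [this, zero_comp, comp_zero]
  comp_self k := by
    rw [adjoint_woldInsert_comp, if_pos rfl, woldUnit_mul_woldUnit hV, if_pos rfl, woldInsert,
      comp_assoc, ← mul_def, woldUnit_mul_woldUnit hV, if_pos rfl]

/-- Common form of both isomorphisms. On e_{ij} ⊗ a, the partial sums of TT⋆ only see the indices k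
in the fibre c k = i, so `hE` is exactly the approximate unit property needed on K ⊗ E. -/
theorem nonempty_starAlgEquiv_compactTensor {V : H →L[ℂ] H} (hV : star V * V = 1)
    {J E : NonUnitalStarSubalgebra ℂ (H →L[ℂ] H)} (hJcl : IsClosed (J : Set (H →L[ℂ] H)))
    (hQ : ∀ x ∈ J, Tendsto (fun m => (1 - V ^ m * star V ^ m) * x) atTop (𝓝 x))
    {c d : ℕ → ℕ} (hcd : ∀ k l, c k = c l → d k = d l → k = l)
    (hJE : ∀ k l, ∀ x ∈ J, woldUnit V (d k) k * x * woldUnit V l (d l) ∈ E)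
    (hEJ : ∀ k l, ∀ a ∈ E, woldUnit V k (d k) * a * woldUnit V (d l) l ∈ J)
    (hE : ∀ i, ∀ a ∈ E, Tendsto (fun m => (∑ k ∈ Finset.range m,
      if c k = i then woldUnit V (d k) (d k) else 0) * a) atTop (𝓝 a)) :
    Nonempty (J ≃⋆ₐ[ℂ] compactTensor E) := by
  have hf := isOrthogonalPartialIsometries_woldInsert hV hcd
  refine hf.nonempty_starAlgEquiv hJcl (NonUnitalStarSubalgebra.isClosed_topologicalClosure _)
    ?_ ?_ ?_ ?_
  · intro k l x hx
    rw [woldInsert_conj]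
    exact matrixUnitTensor_mem_compactTensor (hJE k l x hx) _ _
  · intro k l y hy
    refine compactTensor_induction (p := fun y => adjoint (woldInsert V c d k) ∘L y ∘L
      woldInsert V c d l ∈ J) ?_ ?_ ?_ hy
    · exact hJcl.preimage (f := fun y : EllTwoTensor H →L[ℂ] EllTwoTensor H =>
        adjoint (woldInsert V c d k) ∘L y ∘L woldInsert V c d l) (by fun_prop)
    · intro x y hx hy
      rw [add_comp, comp_add]
      exact add_mem hx hy
    · intro i j a ha
      have h1 : adjoint (tensorInsert (ellTwoBasis j)) ∘L woldInsert V c d l =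
          if c l = j then woldUnit V (d l) l else 0 := by
        have := congrArg adjoint (adjoint_woldInsert_comp_tensorInsert V c d l j)
        rw [ContinuousLinearMap.adjoint_comp, adjoint_adjoint] at this
        rw [this]
        split_ifs
        · rw [adjoint_woldUnit]
        · rw [map_zero]
      have h2 : adjoint (woldInsert V c d k) ∘L (tensorInsert (ellTwoBasis i) ∘L a ∘L
          adjoint (tensorInsert (ellTwoBasis j))) ∘L woldInsert V c d l =
          (if c k = i then woldUnit V k (d k) else 0) * a *
            (if c l = j then woldUnit V (d l) l else 0) := by
        rw [← h1, ← adjoint_woldInsert_comp_tensorInsert]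
        simp only [mul_def, comp_assoc]
      rw [h2]
      split_ifs
      · exact hEJ k l a ha
      all_goals simp
  · intro x hx
    have : ∀ m, ∑ k ∈ Finset.range m, adjoint (woldInsert V c d k) ∘L woldInsert V c d k =
        1 - V ^ m * star V ^ m := fun m => by
      rw [← sum_woldUnit]
      refine Finset.sum_congr rfl fun k _ => ?_
      rw [adjoint_woldInsert_comp, if_pos rfl, woldUnit_mul_woldUnit hV, if_pos rfl]
    simpa only [this] using hQ x hx
  · intro y hy
    -- A uniform bound on the sums of range projections makes the convergence a closed condition, so
    -- generators suffice.
    obtain ⟨M, hM⟩ := hf.comp_adjoint_self.exists_norm_sum_le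
    refine compactTensor_induction (p := fun y => Tendsto (fun m => (∑ k ∈ Finset.range m,
      woldInsert V c d k ∘L adjoint (woldInsert V c d k)) * y) atTop (𝓝 y))
      (isClosed_setOf_tendsto_mul hM) ?_ ?_ hy
    · intro x y hx hy
      simpa only [mul_add] using hx.add hy
    · intro i j a ha
      have h1 : ∀ m, (∑ k ∈ Finset.range m, woldInsert V c d k ∘L adjoint (woldInsert V c d k)) *
          (tensorInsert (ellTwoBasis i) ∘L a ∘L adjoint (tensorInsert (ellTwoBasis j))) =
          tensorInsert (ellTwoBasis i) ∘L ((∑ k ∈ Finset.range m,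
            if c k = i then woldUnit V (d k) (d k) else 0) * a) ∘L
              adjoint (tensorInsert (ellTwoBasis j)) := by
        intro m
        rw [Finset.sum_mul, Finset.sum_mul, finsetSum_comp, comp_finsetSum]
        refine Finset.sum_congr rfl fun k _ => ?_
        rw [mul_def, comp_assoc, ← comp_assoc (adjoint _), adjoint_woldInsert_comp_tensorInsert]
        split_ifs with h
        · subst h
          rw [woldInsert, comp_assoc, ← comp_assoc (woldUnit V _ _), ← mul_def (woldUnit V _ _),
            woldUnit_mul_woldUnit hV, if_pos rfl]
          simp only [mul_def, comp_assoc]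
        · simp
      simp only [h1]
      have hcont : Continuous fun z : H →L[ℂ] H => tensorInsert (ellTwoBasis i) ∘L z ∘L
          adjoint (tensorInsert (ellTwoBasis j)) := by fun_prop
      exact (hcont.tendsto _).comp (hE i a ha)

/-- `J ≅ K ⊗ p J p` for the defect projection `p` of `V`. -/
theorem nonempty_starAlgEquiv_compactTensor_corner {V : H →L[ℂ] H} (hV : star V * V = 1)
    {J : NonUnitalStarSubalgebra ℂ (H →L[ℂ] H)} (hJcl : IsClosed (J : Set (H →L[ℂ] H)))
    (hQ : ∀ x ∈ J, Tendsto (fun m => (1 - V ^ m * star V ^ m) * x) atTop (𝓝 x))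
    (hVJ : ∀ x ∈ J, V * x ∈ J) (hVJ' : ∀ x ∈ J, star V * x ∈ J) {p : H →L[ℂ] H}
    (hpV : p = 1 - V * star V) (hp : IsSelfAdjoint p) (hpJ : p ∈ J) :
    Nonempty (J ≃⋆ₐ[ℂ] compactTensor (corner J p hp hpJ)) := by
  have hJV : ∀ x ∈ J, x * V ∈ J := fun x hx => by
    simpa using star_mem (hVJ' _ (star_mem hx))
  have hJV' : ∀ x ∈ J, x * star V ∈ J := fun x hx => by
    simpa using star_mem (hVJ _ (star_mem hx))
  have hpow : ∀ k, ∀ x ∈ J, V ^ k * x ∈ J := fun k x hx => by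
    induction k with
    | zero => simpa
    | succ k ih => rw [pow_succ', mul_assoc]; exact hVJ _ ih
  have hpow' : ∀ k, ∀ x ∈ J, star V ^ k * x ∈ J := fun k x hx => by
    induction k with
    | zero => simpa
    | succ k ih => rw [pow_succ', mul_assoc]; exact hVJ' _ ih
  have hpowr : ∀ k, ∀ x ∈ J, x * V ^ k ∈ J := fun k x hx => by
    simpa using star_mem (hpow' k _ (star_mem hx))
  have hpowr' : ∀ k, ∀ x ∈ J, x * star V ^ k ∈ J := fun k x hx => by
    simpa using star_mem (hpow k _ (star_mem hx))
  have hpp : p * p = p := by rw [hpV, one_sub_mul_one_sub hV]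
  refine nonempty_starAlgEquiv_compactTensor hV hJcl hQ (c := fun k => k) (d := fun _ => 0)
    (fun k l h _ => h) ?_ ?_ ?_
  · intro k l x hx
    refine ⟨star V ^ k * x * V ^ l, hpowr _ _ (hpow' _ _ hx), ?_⟩
    rw [hpV]
    simp [woldUnit, mul_assoc]
  · rintro k l _ ⟨x, hx, rfl⟩
    have : woldUnit V k 0 * (p * x * p) * woldUnit V 0 l =
        V ^ k * (p * x * p) * star V ^ l := by
      rw [woldUnit, woldUnit, ← hpV]
      calc _ = V ^ k * ((p * p) * x * (p * p)) * star V ^ l := by simp [mul_assoc]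
        _ = _ := by rw [hpp]
    rw [this]
    exact hpowr' _ _ (hpow _ _ (mul_mem (mul_mem hpJ hx) hpJ))
  · rintro i _ ⟨x, hx, rfl⟩
    refine tendsto_const_nhds.congr' ?_
    -- For c k = k and d k = 0 the only contributing term is k = i, equal to p, which is a unit for
    -- the corner.
    filter_upwards [eventually_gt_atTop i] with m hm
    rw [Finset.sum_ite_eq' (Finset.range m) i, if_pos (Finset.mem_range.2 hm), woldUnit_zero_zero,
      ← hpV, ← mul_assoc, ← mul_assoc, hpp]

/-- `J ≅ K ⊗ J`. -/
theorem isStableOn_of_isometry {V : H →L[ℂ] H} (hV : star V * V = 1)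
    {J : NonUnitalStarSubalgebra ℂ (H →L[ℂ] H)} (hJcl : IsClosed (J : Set (H →L[ℂ] H)))
    (hQ : ∀ x ∈ J, Tendsto (fun m => (1 - V ^ m * star V ^ m) * x) atTop (𝓝 x))
    (hVJ : ∀ a b, woldUnit V a b ∈ J) : IsStableOn J := by
  have hcd : ∀ k l : ℕ, k.unpair.1 = l.unpair.1 → k.unpair.2 = l.unpair.2 → k = l :=
    fun k l h1 h2 => by rw [← Nat.pair_unpair k, ← Nat.pair_unpair l, h1, h2]
  refine nonempty_starAlgEquiv_compactTensor hV hJcl hQ (c := fun k => k.unpair.1)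
    (d := fun k => k.unpair.2) hcd (fun k l x hx => mul_mem (mul_mem (hVJ _ _) hx) (hVJ _ _))
    (fun k l x hx => mul_mem (mul_mem (hVJ _ _) hx) (hVJ _ _)) ?_
  intro i a ha
  have hortho : IsOrthogonalPartialIsometries fun k : ℕ =>
      if k.unpair.1 = i then woldUnit V k.unpair.2 k.unpair.2 else 0 := by
    have hadj : ∀ k : ℕ, adjoint (if k.unpair.1 = i then woldUnit V k.unpair.2 k.unpair.2 else 0) =
        if k.unpair.1 = i then woldUnit V k.unpair.2 k.unpair.2 else 0 := fun k => by
      split_ifs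
      · rw [adjoint_woldUnit]
      · rw [map_zero]
    have hmul : ∀ k l : ℕ, k ≠ l →
        (if k.unpair.1 = i then woldUnit V k.unpair.2 k.unpair.2 else 0) ∘L
          (if l.unpair.1 = i then woldUnit V l.unpair.2 l.unpair.2 else 0) = 0 := fun k l hkl => by
      split_ifs with h1 h2
      · rw [← mul_def, woldUnit_mul_woldUnit hV,
          if_neg fun h => hkl (hcd k l (h1.trans h2.symm) h)]
      all_goals simp
    refine ⟨fun k l h => by rw [hadj]; exact hmul k l h,
      fun k l h => by rw [hadj]; exact hmul k l h, fun k => ?_⟩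
    rw [hadj]
    split_ifs
    · rw [← mul_def, ← mul_def, woldUnit_mul_woldUnit hV, if_pos rfl, woldUnit_mul_woldUnit hV,
        if_pos rfl]
    · simp
  obtain ⟨M, hM⟩ := hortho.exists_norm_sum_le
  -- The pairing enumerates the diagonal units in another order, so a is first replaced by its
  -- cut-off (1 - V^N V⋆^N) a. This is a sum over b < N, whose b-th term is fixed once the index
  -- `Nat.pair i b` has been passed.
  refine (isClosed_setOf_tendsto_mul hM).mem_of_tendsto (hQ a ha) (Eventually.of_forall fun N => ?_)
  change Tendsto _ _ _
  rw [← sum_woldUnit, Finset.sum_mul]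
  simp only [Finset.mul_sum]
  refine tendsto_finsetSum _ fun b _ => tendsto_const_nhds.congr' ?_
  filter_upwards [eventually_gt_atTop (Nat.pair i b)] with m hm
  rw [← mul_assoc, Finset.sum_mul, Finset.sum_eq_single_of_mem _ (Finset.mem_range.2 hm)]
  · simp [woldUnit_mul_woldUnit hV]
  · intro k _ hk
    split_ifs with h
    · rw [woldUnit_mul_woldUnit hV, if_neg]
      rintro rfl
      exact hk (by rw [← h, Nat.pair_unpair])
    · simp

end Stabilisation

/-! ### Commutation up to scalars and annihilation by powers of V⋆ -/

section TwistCommute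

variable {A : Type*} [Ring A] [Algebra ℂ A]

/-- `x` and `y` commute up to a nonzero scalar. -/
def TwistCommute (x y : A) : Prop := ∃ c : ℂ, c ≠ 0 ∧ x * y = c • (y * x)

namespace TwistCommute

theorem refl (x : A) : TwistCommute x x := ⟨1, one_ne_zero, by simp⟩

theorem symm {x y : A} (h : TwistCommute x y) : TwistCommute y x := by
  obtain ⟨c, hc, h⟩ := h
  exact ⟨c⁻¹, inv_ne_zero hc, by rw [h, smul_smul, inv_mul_cancel₀ hc, one_smul]⟩

theorem one_right (x : A) : TwistCommute x 1 := ⟨1, one_ne_zero, by simp⟩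

theorem mul_right {x y z : A} (hy : TwistCommute x y) (hz : TwistCommute x z) :
    TwistCommute x (y * z) := by
  obtain ⟨c, hc, h⟩ := hy
  obtain ⟨c', hc', h'⟩ := hz
  refine ⟨c * c', mul_ne_zero hc hc', ?_⟩
  rw [← mul_assoc, h, smul_mul_assoc, mul_assoc, h', mul_smul_comm, smul_smul, mul_assoc]

theorem listProd_right {x : A} {l : List A} (h : ∀ y ∈ l, TwistCommute x y) :
    TwistCommute x l.prod := by
  induction l with
  | nil => exact one_right x
  | cons y l ih =>
    rw [List.prod_cons]
    exact (h y (by simp)).mul_right (ih fun z hz => h z (by simp [hz]))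

theorem pow_right {x y : A} (h : TwistCommute x y) (k : ℕ) : TwistCommute x (y ^ k) := by
  induction k with
  | zero => simpa using one_right x
  | succ k ih => rw [pow_succ]; exact ih.mul_right h

theorem star_star [StarRing A] [StarModule ℂ A] {x y : A} (h : TwistCommute x y) :
    TwistCommute (star x) (star y) := by
  obtain ⟨c, hc, h⟩ := h.symm
  exact ⟨star c, star_ne_zero.2 hc, by rw [← star_mul, h, star_smul, star_mul]⟩

end TwistCommute

end TwistCommute

section ListProd

theorem star_listProd_mul_listProd {A : Type*} [Ring A] [StarRing A] {l : List A}
    (h : ∀ x ∈ l, star x * x = 1) : star l.prod * l.prod = 1 := by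
  induction l with
  | nil => simp
  | cons x l ih =>
    rw [List.prod_cons, star_mul, mul_assoc, ← mul_assoc (star x), h x (by simp), one_mul]
    exact ih fun y hy => h y (by simp [hy])

end ListProd

namespace IsTwistedTuple

variable {m n : ℕ} {θ : Fin (m + n) → Fin (m + n) → ℝ} {A : Type*} [Ring A] [StarRing A]
  [Algebra ℂ A] [StarModule ℂ A] {s : Fin (m + n) → A}

omit [StarModule ℂ A] in
theorem twistCommute (hs : IsTwistedTuple m n θ s) (i j : Fin (m + n)) :
    TwistCommute (s i) (s j) := by
  rcases lt_trichotomy i j with h | rfl | h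
  · exact ⟨_, Complex.exp_ne_zero _, hs.twist i j h⟩
  · exact TwistCommute.refl _
  · exact TwistCommute.symm ⟨_, Complex.exp_ne_zero _, hs.twist j i h⟩

omit [StarModule ℂ A] in
theorem star_prod_mul_prod (hs : IsTwistedTuple m n θ s) :
    star (List.ofFn s).prod * (List.ofFn s).prod = 1 :=
  star_listProd_mul_listProd fun x hx => by
    obtain ⟨i, rfl⟩ := List.mem_ofFn.1 hx
    exact hs.isometry i

omit [StarModule ℂ A] in
theorem twistCommute_prod (hs : IsTwistedTuple m n θ s) (i : Fin (m + n)) :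
    TwistCommute (s i) (List.ofFn s).prod :=
  TwistCommute.listProd_right fun y hy => by
    obtain ⟨j, rfl⟩ := List.mem_ofFn.1 hy
    exact hs.twistCommute i j

omit [StarModule ℂ A] in
/-- Each generator can be split off the product of all generators. -/
theorem exists_prod_eq (hs : IsTwistedTuple m n θ s) (i : Fin (m + n)) :
    ∃ c : ℂ, ∃ w : A, (List.ofFn s).prod = c • (s i * w) ∧
      TwistCommute (List.ofFn s).prod w := by
  obtain ⟨l₁, l₂, hl⟩ := List.append_of_mem (List.mem_ofFn.2 ⟨i, rfl⟩ : s i ∈ List.ofFn s)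
  have hmem : ∀ y ∈ l₁ ++ l₂, ∃ j, s j = y := fun y hy => by
    refine List.mem_ofFn.1 (hl ▸ ?_)
    rcases List.mem_append.1 hy with h | h <;> simp [h]
  obtain ⟨c, -, h⟩ : TwistCommute l₁.prod (s i) := TwistCommute.symm
    (TwistCommute.listProd_right fun y hy => by
      obtain ⟨j, rfl⟩ := hmem y (by simp [hy])
      exact hs.twistCommute i j)
  -- The scalar c is the cost of moving s_i to the front past l₁.
  refine ⟨c, l₁.prod * l₂.prod, ?_, ?_⟩
  · rw [hl, List.prod_append, List.prod_cons, ← mul_assoc, h, smul_mul_assoc, mul_assoc]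
  · rw [← List.prod_append]
    refine TwistCommute.listProd_right fun y hy => ?_
    obtain ⟨j, rfl⟩ := hmem y hy
    exact (hs.twistCommute_prod j).symm

/-- High powers of the adjoint of the product annihilate every `⋆`-polynomial in the generators
multiplied with the defect projection. -/
theorem exists_star_pow_mul_eq_zero (hs : IsTwistedTuple m n θ s) {a : A}
    (ha : a ∈ StarAlgebra.adjoin ℂ (Set.range s)) :
    ∃ K, ∀ k, K ≤ k → star (List.ofFn s).prod ^ k *
      (a * (1 - (List.ofFn s).prod * star (List.ofFn s).prod)) = 0 := by
  set V := (List.ofFn s).prod with hV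
  have hVV : star V * V = 1 := hs.star_prod_mul_prod
  -- Left multiplication by a preserves the elements killed by high powers of V⋆. Quantifying over y
  -- lets the induction pass through products; the defect is such a y, with K = 1.
  suffices h : ∀ y, (∃ K, ∀ k, K ≤ k → star V ^ k * y = 0) →
      ∃ K, ∀ k, K ≤ k → star V ^ k * (a * y) = 0 by
    refine h _ ⟨1, fun k hk => ?_⟩
    obtain ⟨k, rfl⟩ := Nat.exists_eq_add_of_le' hk
    rw [pow_succ, mul_assoc, star_mul_one_sub hVV, mul_zero]
  rw [← StarSubalgebra.mem_toSubalgebra, StarAlgebra.adjoin_toSubalgebra] at ha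
  induction ha using Algebra.adjoin_induction with
  | mem x hx =>
    rintro y ⟨K, hK⟩
    rcases hx with ⟨i, rfl⟩ | ⟨i, hi⟩
    swap
    · obtain rfl : x = star (s i) := by rw [hi, star_star]
      refine ⟨K, fun k hk => ?_⟩
      obtain ⟨c, -, h⟩ := ((hs.twistCommute_prod i).star_star.pow_right k).symm
      rw [← mul_assoc, h, smul_mul_assoc, mul_assoc, hK k hk, mul_zero, smul_zero]
    obtain ⟨c, w, hw, hVw⟩ := hs.exists_prod_eq i
    have h1 : star V * s i = star c • star w := by
      rw [hV, hw, star_smul, star_mul, smul_mul_assoc, mul_assoc, hs.isometry, mul_one]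
    -- One power of V⋆ is spent on absorbing s_i into w⋆; the others pass through w⋆ up to a scalar.
    refine ⟨K + 1, fun k hk => ?_⟩
    obtain ⟨k, rfl⟩ := Nat.exists_eq_add_of_le' (show 1 ≤ k by omega)
    obtain ⟨c', -, h2⟩ := (hVw.star_star.symm.pow_right k).symm
    rw [pow_succ, ← mul_assoc, mul_assoc _ (star V), h1, mul_smul_comm, h2, smul_mul_assoc,
      smul_mul_assoc, mul_assoc, hK k (by omega), mul_zero, smul_zero,
      smul_zero]
  | algebraMap r =>
    rintro y ⟨K, hK⟩
    refine ⟨K, fun k hk => ?_⟩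
    rw [← Algebra.smul_def, mul_smul_comm, hK k hk, smul_zero]
  | add x z _ _ hx hz =>
    intro y hy
    obtain ⟨K, hK⟩ := hx y hy
    obtain ⟨L, hL⟩ := hz y hy
    refine ⟨max K L, fun k hk => ?_⟩
    rw [add_mul, mul_add, hK k (le_of_max_le_left hk), hL k (le_of_max_le_right hk), add_zero]
  | mul x z _ _ hx hz =>
    intro y hy
    simpa only [mul_assoc] using hx _ (hz y hy)

end IsTwistedTuple

/-! ### Ranges of ⋆-homomorphisms are closed -/

section ClosedRange

open scoped ComplexStarModule

variable {A B : Type*} [NonUnitalCStarAlgebra A] [NonUnitalCStarAlgebra B]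

theorem NonUnitalStarAlgHom.continuous_of_cstar (φ : A →⋆ₙₐ[ℂ] B) : Continuous φ :=
  AddMonoidHomClass.continuous_of_bound φ 1 fun x => by
    simpa using NonUnitalStarAlgHom.norm_apply_le φ x

/-- Self-adjoint elements of the range of a `⋆`-homomorphism lift without increase of norm. -/
theorem NonUnitalStarAlgHom.exists_lift_norm_le_of_isSelfAdjoint (φ : A →⋆ₙₐ[ℂ] B) {x : A}
    (hx : IsSelfAdjoint x) : ∃ z, φ z = φ x ∧ ‖z‖ ≤ ‖φ x‖ := by
  set r := ‖φ x‖
  have hr : 0 ≤ r := norm_nonneg _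
  have hφ : Continuous φ := φ.continuous_of_cstar
  have hφx : IsSelfAdjoint (φ x) := hx.map φ
  -- Clamping to [-r, r] is the identity on the spectrum of φ x, so f(x) is still a lift, now of
  -- norm at most r. The non-unital calculus needs f 0 = 0.
  let f : ℝ → ℝ := fun t => max (-r) (min r t)
  have hf : Continuous f := by fun_prop
  have hf0 : f 0 = 0 := by simp [f, hr]
  refine ⟨cfcₙ f x, ?_, ?_⟩
  · rw [NonUnitalStarAlgHomClass.map_cfcₙ (S := ℂ) φ f x hf.continuousOn hf0 hφ hx hφx]
    refine (cfcₙ_congr fun t ht => ?_).trans (cfcₙ_id' ℝ (φ x))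
    have h1 := norm_apply_le_norm_cfcₙ (fun t : ℝ => t) (φ x) ht
    rw [cfcₙ_id' ℝ (φ x), Real.norm_eq_abs, abs_le] at h1
    change max (-r) (min r t) = t
    rw [min_eq_right h1.2, max_eq_right h1.1]
  · refine norm_cfcₙ_le fun t _ => ?_
    rw [Real.norm_eq_abs, abs_le]
    exact ⟨le_max_left _ _, max_le (by linarith) (min_le_left _ _)⟩

/-- The range of a `⋆`-homomorphism of C⋆-algebras is closed. -/
theorem NonUnitalStarAlgHom.isClosed_range_of_cstar (φ : A →⋆ₙₐ[ℂ] B) :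
    IsClosed (Set.range φ) := by
  let f : NormedAddGroupHom A B :=
    { toFun := φ
      map_add' := map_add φ
      bound' := ⟨1, fun x => by simpa using NonUnitalStarAlgHom.norm_apply_le φ x⟩ }
  -- The constant 2 comes from lifting real and imaginary parts separately; a norm-controlled lift
  -- then extends to the closure of the range by completeness.
  have hsurj : f.SurjectiveOnWith f.range 2 := by
    rintro _ ⟨x, rfl⟩
    change ∃ g, φ g = φ x ∧ ‖g‖ ≤ 2 * ‖φ x‖
    obtain ⟨a, ha, ha'⟩ := φ.exists_lift_norm_le_of_isSelfAdjoint (ℜ x).2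
    obtain ⟨b, hb, hb'⟩ := φ.exists_lift_norm_le_of_isSelfAdjoint (ℑ x).2
    have h1 : φ (ℜ x : A) = (ℜ (φ x) : B) := by
      simp only [realPart_apply_coe, ← Complex.coe_smul, map_smul, map_add, map_star]
    have h2 : φ (ℑ x : A) = (ℑ (φ x) : B) := by
      simp only [imaginaryPart_apply_coe, ← Complex.coe_smul, map_smul, map_sub, map_star]
    refine ⟨a + Complex.I • b, ?_, ?_⟩
    · rw [map_add, map_smul, ha, hb, h1, h2, realPart_add_I_smul_imaginaryPart]
    · have h3 : ‖a‖ ≤ ‖φ x‖ := ha'.trans (by rw [h1]; exact realPart.norm_le (φ x))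
      have h4 : ‖b‖ ≤ ‖φ x‖ := hb'.trans (by rw [h2]; exact imaginaryPart.norm_le (φ x))
      calc ‖a + Complex.I • b‖ ≤ ‖a‖ + ‖Complex.I • b‖ := norm_add_le _ _
        _ = ‖a‖ + ‖b‖ := by rw [norm_smul, Complex.norm_I, one_mul]
        _ ≤ _ := by linarith
  have hcl := controlled_closure_of_complete two_pos one_pos hsurj
  refine isClosed_of_closure_subset fun y hy => ?_
  obtain ⟨x, hx, -⟩ := hcl y hy
  exact ⟨x, hx⟩

end ClosedRange

/-! ### The diagonal representation on a Hilbert sum -/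

section DirectSum

open ContinuousLinearMap

variable {ι : Type*} {G : ι → Type*} [∀ i, NormedAddCommGroup (G i)]
  [∀ i, InnerProductSpace ℂ (G i)] [∀ i, CompleteSpace (G i)]

omit [∀ i, CompleteSpace (G i)] in
-- Domination by a multiple of x yields both square summability and the operator bound in
-- `diagonalOperator`.
theorem norm_lpInfty_apply_le (T : lp (fun i => G i →L[ℂ] G i) ∞) (x : lp G 2) (i : ι) :
    ‖T i (x i)‖ ≤ ‖((‖T‖ : ℂ) • x) i‖ := by
  have h : ‖((‖T‖ : ℂ) • x) i‖ = ‖T‖ * ‖x i‖ := by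
    rw [lp.coeFn_smul, Pi.smul_apply, norm_smul, Complex.norm_real, norm_norm]
  rw [h]
  exact (T i).le_of_opNorm_le (lp.norm_apply_le_norm (by simp) T i) _

/-- A bounded family of operators acting diagonally on the Hilbert sum. -/
noncomputable def diagonalOperator (T : lp (fun i => G i →L[ℂ] G i) ∞) : lp G 2 →L[ℂ] lp G 2 :=
  LinearMap.mkContinuous
    { toFun := fun x => ⟨fun i => T i (x i),
        (lp.memℓp ((‖T‖ : ℂ) • x)).mono' (norm_lpInfty_apply_le T x)⟩
      map_add' := fun x y => by
        apply lp.ext; funext i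
        exact map_add (T i) (x i) (y i)
      map_smul' := fun c x => by
        apply lp.ext; funext i
        exact map_smul (T i) c (x i) }
    ‖T‖ fun x => by
      refine (lp.norm_mono (by simp) (norm_lpInfty_apply_le T x)).trans ?_
      rw [norm_smul, Complex.norm_real, norm_norm]

variable [∀ i, Nontrivial (G i)]

/-- The diagonal representation of a product of operator algebras on the Hilbert sum. -/
noncomputable def diagonalRepresentation :
    lp (fun i => G i →L[ℂ] G i) ∞ →⋆ₐ[ℂ] (lp G 2 →L[ℂ] lp G 2) where
  toFun := diagonalOperator
  map_one' := rfl
  map_mul' _ _ := rfl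
  map_zero' := rfl
  map_add' _ _ := rfl
  commutes' _ := rfl
  map_star' T := by
    rw [star_eq_adjoint, eq_adjoint_iff]
    intro x y
    rw [lp.inner_eq_tsum, lp.inner_eq_tsum]
    refine tsum_congr fun i => ?_
    exact adjoint_inner_left (T i) (y i) (x i)

theorem diagonalRepresentation_injective :
    Function.Injective (diagonalRepresentation (G := G)) := by
  classical
  intro S T hST
  apply lp.ext; funext i; ext v
  have h := congrArg (fun A : lp G 2 →L[ℂ] lp G 2 => A (lp.single 2 i v) i) hST
  change S i (lp.single 2 i v i) = T i (lp.single 2 i v i) at h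
  simpa using h

end DirectSum

/-! ### The defect ideal and its images -/

namespace FreeTwist

open Filter Topology

variable (m n : ℕ) (θ : Fin (m + n) → Fin (m + n) → ℝ)

theorem star_prodGen_mul_prodGen : star (prodGen m n θ) * prodGen m n θ = 1 :=
  (isTwistedTuple_gen m n θ).star_prod_mul_prod

variable {m n θ}

theorem mul_mem_defectIdeal (a : FreeTwist m n θ) {x : FreeTwist m n θ}
    (hx : x ∈ defectIdeal m n θ) : a * x ∈ defectIdeal m n θ :=
  map_mem_closure (continuous_const_mul a) hx fun _ hy =>
    (TwoSidedIdeal.span {defect m n θ}).mul_mem_left a _ hy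

theorem mem_defectIdeal_mul (a : FreeTwist m n θ) {x : FreeTwist m n θ}
    (hx : x ∈ defectIdeal m n θ) : x * a ∈ defectIdeal m n θ :=
  map_mem_closure (f := fun x => x * a) (by fun_prop) hx fun _ hy =>
    (TwoSidedIdeal.span {defect m n θ}).mul_mem_right _ a hy

theorem woldUnit_mem_defectIdeal (a b : ℕ) :
    woldUnit (prodGen m n θ) a b ∈ defectIdeal m n θ :=
  mem_defectIdeal_mul _ (mul_mem_defectIdeal _ (defect_mem_defectIdeal m n θ))

theorem norm_one_sub_pow_le (k : ℕ) :
    ‖1 - prodGen m n θ ^ k * star (prodGen m n θ) ^ k‖ ≤ 1 := by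
  have h := star_pow_mul_pow (star_prodGen_mul_prodGen m n θ) k
  refine IsStarProjection.norm_le _ (IsStarProjection.one_sub ⟨?_, ?_⟩)
  · rw [IsIdempotentElem, mul_assoc, ← mul_assoc (star _ ^ k), h, one_mul]
  · simp [IsSelfAdjoint]

/-- The projections `1 - V^k V⋆^k` form an approximate unit of the defect ideal. -/
theorem tendsto_one_sub_mul {x : FreeTwist m n θ} (hx : x ∈ defectIdeal m n θ) :
    Tendsto (fun k => (1 - prodGen m n θ ^ k * star (prodGen m n θ) ^ k) * x) atTop (𝓝 x) := by
  set V := prodGen m n θ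
  have hcl := isClosed_setOf_tendsto_mul (norm_one_sub_pow_le (m := m) (n := n) (θ := θ))
  refine closure_minimal (t := {x | Tendsto (fun k => (1 - V ^ k * star V ^ k) * x) atTop (𝓝 x)})
    (fun x hx => ?_) hcl hx
  rw [SetLike.mem_coe, TwoSidedIdeal.mem_span_iff_mem_addSubgroup_closure] at hx
  induction hx using AddSubgroup.closure_induction with
  | zero => simp
  | add x y _ _ hx hy => simpa only [Set.mem_ofPred_eq, mul_add] using hx.add hy
  | neg x _ hx => simpa only [Set.mem_ofPred_eq, mul_neg] using hx.neg
  | mem x hx =>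
    obtain ⟨_, ⟨a, -, s, hs, rfl⟩, b, -, rfl⟩ := hx
    obtain rfl : s = defect m n θ := hs
    have ha : a ∈ closure (StarAlgebra.adjoin ℂ (Set.range (gen m n θ)) :
        Set (FreeTwist m n θ)) := by
      have : a ∈ (StarAlgebra.adjoin ℂ (Set.range (gen m n θ))).topologicalClosure := by
        rw [topologicalClosure_adjoin_gen]; trivial
      exact this
    -- The condition is closed in a, so a may be taken to be a ⋆-polynomial in the generators, and
    -- then the sequence is eventually constant; b stays arbitrary.
    refine closure_minimal (t := (fun a => a * defect m n θ * b) ⁻¹'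
      {x | Tendsto (fun k => (1 - V ^ k * star V ^ k) * x) atTop (𝓝 x)}) (fun a ha => ?_)
      (hcl.preimage (by fun_prop)) ha
    obtain ⟨K, hK⟩ := (isTwistedTuple_gen m n θ).exists_star_pow_mul_eq_zero ha
    refine tendsto_const_nhds.congr' ?_
    filter_upwards [eventually_ge_atTop K] with k hk
    have : star V ^ k * (a * defect m n θ) = 0 := hK k hk
    rw [sub_mul, one_mul, mul_assoc (V ^ k), ← mul_assoc _ _ b, this]
    simp

variable {H : Type*} [NormedAddCommGroup H] [InnerProductSpace ℂ H] [CompleteSpace H]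
  (π : FreeTwist m n θ →⋆ₐ[ℂ] (H →L[ℂ] H))

theorem isClosed_imageIdeal : IsClosed (imageIdeal π : Set (H →L[ℂ] H)) := by
  let φ : defectIdeal m n θ →⋆ₙₐ[ℂ] (H →L[ℂ] H) :=
    π.toNonUnitalStarAlgHom.comp (NonUnitalStarSubalgebraClass.subtype (defectIdeal m n θ))
  have h : (imageIdeal π : Set (H →L[ℂ] H)) = Set.range φ := by
    refine Set.ext fun y => ⟨?_, ?_⟩
    · rintro ⟨x, hx, rfl⟩
      exact ⟨⟨x, hx⟩, rfl⟩
    · rintro ⟨⟨x, hx⟩, rfl⟩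
      exact ⟨x, hx, rfl⟩
  rw [h]
  exact φ.isClosed_range_of_cstar

theorem star_map_prodGen_mul :
    star (π (prodGen m n θ)) * π (prodGen m n θ) = 1 := by
  rw [← map_star, ← map_mul, star_prodGen_mul_prodGen, map_one]

theorem map_defect :
    π (defect m n θ) = 1 - π (prodGen m n θ) * star (π (prodGen m n θ)) := by
  rw [defect, map_sub, map_one, map_mul, map_star]

/-- As p is idempotent, the corner is the part of the closed algebra π(J) on which y = p y p. -/
theorem isClosed_imageCorner : IsClosed (imageCorner π : Set (H →L[ℂ] H)) := by
  have hp : π (defect m n θ) * π (defect m n θ) = π (defect m n θ) := by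
    rw [map_defect, one_sub_mul_one_sub (star_map_prodGen_mul π)]
  have hpJ : π (defect m n θ) ∈ imageIdeal π := ⟨_, defect_mem_defectIdeal m n θ, rfl⟩
  have : (imageCorner π : Set (H →L[ℂ] H)) = (imageIdeal π : Set (H →L[ℂ] H)) ∩
      {y | π (defect m n θ) * y * π (defect m n θ) = y} := by
    ext y
    constructor
    · rintro ⟨x, hx, rfl⟩
      refine ⟨mul_mem (mul_mem hpJ hx) hpJ, ?_⟩
      calc _ = (π (defect m n θ) * π (defect m n θ)) * x *
            (π (defect m n θ) * π (defect m n θ)) := by simp only [mul_assoc]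
        _ = _ := by rw [hp]
    · rintro ⟨hy, hy'⟩
      exact ⟨y, hy, hy'⟩
  rw [this]
  exact (isClosed_imageIdeal π).inter (isClosed_eq (by fun_prop) continuous_id)

theorem tendsto_imageIdeal {y : H →L[ℂ] H} (hy : y ∈ imageIdeal π) :
    Tendsto (fun k => (1 - π (prodGen m n θ) ^ k * star (π (prodGen m n θ)) ^ k) * y) atTop
      (𝓝 y) := by
  obtain ⟨x, hx, rfl⟩ := hy
  have h := (π.toNonUnitalStarAlgHom.continuous_of_cstar.tendsto _).comp (tendsto_one_sub_mul hx)
  have h2 : ∀ k, (1 - π (prodGen m n θ) ^ k * star (π (prodGen m n θ)) ^ k) * π x =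
      π ((1 - prodGen m n θ ^ k * star (prodGen m n θ) ^ k) * x) := fun k => by
    simp only [map_mul, map_sub, map_one, map_pow, map_star]
  change Tendsto (fun k => _ * π x) _ (𝓝 (π x))
  simp only [h2]
  exact h

theorem map_mul_mem_imageIdeal (a : FreeTwist m n θ) {y : H →L[ℂ] H} (hy : y ∈ imageIdeal π) :
    π a * y ∈ imageIdeal π := by
  obtain ⟨x, hx, rfl⟩ := hy
  exact ⟨a * x, mul_mem_defectIdeal a hx, map_mul π a x⟩

theorem nonempty_imageIdeal_equiv :
    Nonempty (imageIdeal π ≃⋆ₐ[ℂ] compactTensor (imageCorner π)) := by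
  refine nonempty_starAlgEquiv_compactTensor_corner (star_map_prodGen_mul π)
    (isClosed_imageIdeal π) (fun _ => tendsto_imageIdeal π)
    (fun _ => map_mul_mem_imageIdeal π _) (fun x hx => ?_) (map_defect π) _ _
  rw [← map_star]
  exact map_mul_mem_imageIdeal π _ hx

theorem isStableOn_imageIdeal : IsStableOn (imageIdeal π) := by
  refine isStableOn_of_isometry (star_map_prodGen_mul π) (isClosed_imageIdeal π)
    (fun _ => tendsto_imageIdeal π) fun a b => ⟨_, woldUnit_mem_defectIdeal a b, ?_⟩
  change π (woldUnit _ a b) = _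
  simp only [woldUnit, map_mul, map_sub, map_one, map_pow, map_star]

variable (m n θ)

/-- The universal representation, on the Hilbert sum of all tuples. -/
noncomputable def universalRepresentation : FreeTwist m n θ →⋆ₐ[ℂ]
    (lp (fun r : TwistedTuple m n θ => r.H) 2 →L[ℂ] lp (fun r : TwistedTuple m n θ => r.H) 2) :=
  (diagonalRepresentation (G := fun r : TwistedTuple m n θ => r.H)).comp
    (freeTwistSubalgebra m n θ).subtype

theorem universalRepresentation_injective :
    Function.Injective (universalRepresentation m n θ) :=
  diagonalRepresentation_injective.comp Subtype.val_injective

theorem isStable_defectIdeal : IsStable (defectIdeal m n θ) := by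
  refine ⟨lp (fun r : TwistedTuple m n θ => r.H) 2, inferInstance, inferInstance, inferInstance,
    (universalRepresentation m n θ).toNonUnitalStarAlgHom.comp
      (NonUnitalStarSubalgebraClass.subtype (defectIdeal m n θ)),
    (universalRepresentation_injective m n θ).comp Subtype.val_injective, ?_⟩
  -- The range of the faithful representation restricted to J is the image ideal, already known to
  -- be stable.
  convert isStableOn_imageIdeal (universalRepresentation m n θ)
  ext y
  constructor
  · rintro ⟨⟨x, hx⟩, rfl⟩
    exact ⟨x, hx, rfl⟩
  · rintro ⟨x, hx, rfl⟩
    exact ⟨⟨x, hx⟩, rfl⟩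

end FreeTwist

theorem mainTheorem10 (m n : ℕ) (hmn : 1 < m + n) (θ : Fin (m + n) → Fin (m + n) → ℝ) :
    (∀ (H : Type*) [NormedAddCommGroup H] [InnerProductSpace ℂ H] [CompleteSpace H]
      (π : FreeTwist m n θ →⋆ₐ[ℂ] (H →L[ℂ] H)),
      IsClosed (FreeTwist.imageIdeal π : Set (H →L[ℂ] H)) ∧
      IsClosed (FreeTwist.imageCorner π : Set (H →L[ℂ] H)) ∧
      Nonempty (FreeTwist.imageIdeal π ≃⋆ₐ[ℂ] compactTensor (FreeTwist.imageCorner π)) ∧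
      IsStableOn (FreeTwist.imageIdeal π)) ∧
    IsStable (FreeTwist.defectIdeal m n θ) := by
  exact ⟨fun H _ _ _ π => ⟨FreeTwist.isClosed_imageIdeal π, FreeTwist.isClosed_imageCorner π,
    FreeTwist.nonempty_imageIdeal_equiv π, FreeTwist.isStableOn_imageIdeal π⟩,
    FreeTwist.isStable_defectIdeal m n θ⟩
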